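/- Let $p>3$ be a prime with $p\equiv 3 \pmod 4$, let $g$ be a primitive root modulo $p$, and let $b\ge 2$ be an integer that is a quadratic residue modulo $p$ (so $p\nmid b$). Let $d$ be the multiplicative order of $b$ modulo $p$. For $j=0,1,\dots,\frac{p-1}{2d}-1$ let $b_j\in\{1,\dots,p-1\}$ be the representative of $g^{2j}$ modulo $p$, and let $$\frac{b_j}{p}=\sum_{k=1}^{\infty}a_k^{(j)}b^{-k},\qquad a_k^{(j)}\in\{0,1,\dots,b-1\},$$ be its base-$b$ digit expansion. Each of these expansions is purely periodic with (shortest) period $(a_1^{(j)},a_2^{(j)},\dots,a_d^{(j)})$, and the digit sums $S_j=a_1^{(j)}+a_2^{(j)}+\cdots+a_d^{(j)}$ of the periods satisfy $$S_0+S_1+\cdots+S_{(p-1)/(2d)-1}=\frac{(b-1)(p-1)}{4}-\frac{(b-1)\,h_2^-}{2},$$ where $h_2^-$ is the class number of the imaginary quadratic field $\mathbb{Q}(\sqrt{-p})$ (which is also its relative class number). -/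

import Mathlib

/-- The imaginary quadratic field `ℚ(√-p)`, as a subfield of `ℂ`. -/
noncomputable abbrev QSqrtNeg (p : ℕ) : IntermediateField ℚ ℂ :=
  IntermediateField.adjoin ℚ {Complex.I * ((Real.sqrt (p : ℝ) : ℝ) : ℂ)}

instance QSqrtNeg.instNumberField (p : ℕ) : NumberField (QSqrtNeg p) where
  to_charZero := inferInstance
  to_finiteDimensional := by
    apply IntermediateField.adjoin.finiteDimensional
    have h : (Complex.I * ((Real.sqrt (p : ℝ) : ℝ) : ℂ)) ^ 2 = -(p : ℂ) := by
      rw [mul_pow, Complex.I_sq, ← Complex.ofReal_pow, Real.sq_sqrt (Nat.cast_nonneg p)]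
      simp
    refine IsIntegral.of_pow (n := 2) (by norm_num) ?_
    rw [h]
    exact (isIntegral_algebraMap (R := ℚ) (A := ℂ) (x := (p : ℚ))).neg

/-- The class number `h₂⁻` of `ℚ(√-p)` (for a prime `p ≡ 3 mod 4` this is also its relative
class number, since the maximal real subfield is `ℚ`). -/
noncomputable def h2minus (p : ℕ) : ℕ := NumberField.classNumber (QSqrtNeg p)

/-- `b_j = (g^{2j})_p`, the representative of `g^{2j}` modulo `p` in `{0, …, p - 1}`. -/
def residueRep (p : ℕ) (g : ℤ) (j : ℕ) : ℤ := g ^ (2 * j) % (p : ℤ)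

/-- `periodDigit p b g j k` is the digit `a_{k+1}^{(j)}` in the base-`b` expansion
`b_j / p = ∑_{k ≥ 0} a_{k+1}^{(j)} b^{-(k+1)}`. -/
noncomputable def periodDigit (p b : ℕ) [NeZero b] (g : ℤ) (j k : ℕ) : ℕ :=
  (Real.digits ((residueRep p g j : ℝ) / (p : ℝ)) b k : ℕ)

/-! Write r_k for the remainders g^(2j) b^k mod p of the long division of b_j by p. Each step gives
p a_(k+1) = b r_k - r_(k+1). The remainders return after d steps, so telescoping gives p S_j = (b-1)
Σ r_k (`mul_sum_periodDigit`). Since b is a square, the products g^(2j) b^k run once through the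
nonzero squares (`sum_sum_pow_mul_pow`), so p Σ S_j is (b-1) times the sum of the quadratic residues
in 1..p-1. With χ the quadratic character, twice that sum is p(p-1)/2 + Σ χ(a) a, and everything
reduces to the class number formula p h = -Σ χ(a) a (`p_mul_h2minus`).

That formula compares two values of the residue at s = 1 of the Dedekind zeta function of K =
ℚ(√-p). The analytic class number formula gives π h / √p, once the discriminant, units and places of
K are known (`dedekindZeta_residue_eq`). On the other side, counting ideals by norm yields ζ_K(s) =
ζ(s) L(s, χ) (`dedekindZeta_eq`), so the residue is also the limit of L(s, χ) at 1. Expanding χ in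
additive characters turns this limit into a combination of the logarithms log(1 - ζ^a), of which
oddness of χ keeps only the arguments (`tendsto_LSeries_quadraticChar`).

The expansion needs the Gauss sum itself, not only its square -p. Its sign is found by excluding the
value -i√p: that value is an explicit product of factors ζ^a - 1 up to powers of ζ, and the
resulting polynomial congruence modulo p fails at (X-1)-adic order m = (p-1)/2
(`sum_legendreSym_mul_pow_ne_halfProd`). -/

section

/-! ### Long division, digits and their periods -/

open Finset

/-- The remainder after `k` steps of the long division of `r` by `p` in base `b`. -/
theorem mul_pow_succ_div_mod_mul_add (p b r k : ℕ) (hp : 0 < p) (hb : 0 < b) :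
    p * (r * b ^ (k + 1) / p % b) + r * b ^ (k + 1) % p = b * (r * b ^ k % p) := by
  have h1 : r * b ^ (k + 1) = b * (r * b ^ k % p) + p * (b * (r * b ^ k / p)) := by
    have := Nat.div_add_mod (r * b ^ k) p
    calc r * b ^ (k + 1) = b * (r * b ^ k) := by ring
      _ = b * (p * (r * b ^ k / p) + r * b ^ k % p) := by rw [this]
      _ = _ := by ring
  have h2 : b * (r * b ^ k % p) / p < b := by
    rw [Nat.div_lt_iff_lt_mul hp]
    exact Nat.mul_lt_mul_of_pos_left (Nat.mod_lt _ hp) hb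
  rw [h1, Nat.add_mul_div_left _ _ hp, Nat.add_mul_mod_self_left, Nat.add_mul_mod_self_left,
    Nat.mod_eq_of_lt h2, Nat.div_add_mod]

theorem digits_natCast_div_natCast (p b r k : ℕ) [NeZero b] :
    (Real.digits ((r : ℝ) / p) b k : ℕ) = r * b ^ (k + 1) / p % b := by
  rw [Real.digits, Fin.val_ofNat]
  congr 1
  rw [div_mul_eq_mul_div]
  exact_mod_cast Nat.floor_div_eq_div (K := ℝ) (r * b ^ (k + 1)) p

theorem residueRep_eq_val (p : ℕ) [NeZero p] (g : ℤ) (j : ℕ) :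
    residueRep p g j = (((g : ZMod p) ^ (2 * j)).val : ℤ) := by
  rw [residueRep, ← ZMod.val_intCast]
  push_cast
  rfl

section Periods

variable (p b : ℕ) [Fact p.Prime] [NeZero b] (g : ℤ)

theorem mul_periodDigit_add_val (j k : ℕ) :
    p * periodDigit p b g j k + ((g : ZMod p) ^ (2 * j) * (b : ZMod p) ^ (k + 1)).val =
      b * ((g : ZMod p) ^ (2 * j) * (b : ZMod p) ^ k).val := by
  have hp : 0 < p := (Fact.out : p.Prime).pos
  have hv (k : ℕ) : ((g : ZMod p) ^ (2 * j) * (b : ZMod p) ^ k).val =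
      ((g : ZMod p) ^ (2 * j)).val * b ^ k % p := by
    rw [← ZMod.val_natCast]
    push_cast
    rw [ZMod.natCast_rightInverse]
  have hr : (residueRep p g j : ℝ) = (((g : ZMod p) ^ (2 * j)).val : ℝ) := by
    rw [residueRep_eq_val]; norm_cast
  rw [periodDigit, hr, digits_natCast_div_natCast, hv, hv]
  exact mul_pow_succ_div_mod_mul_add p b _ k hp (NeZero.pos b)

/-- If the digits repeat after m steps, the differences δ_k = r_(k+m) - r_k of remainders satisfy
δ_(k+1) = b δ_k. They would grow geometrically while staying below p in absolute value, so δ_0 = 0.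
-/
theorem periodic_periodDigit_iff (hb : 2 ≤ b) (hg : (g : ZMod p) ≠ 0) (j m : ℕ) :
    Function.Periodic (periodDigit p b g j) m ↔ (b : ZMod p) ^ m = 1 := by
  have hp : 0 < p := (Fact.out : p.Prime).pos
  set x := (g : ZMod p) ^ (2 * j) with hx
  have hx0 : x ≠ 0 := pow_ne_zero _ hg
  have key := mul_periodDigit_add_val p b g j
  constructor
  · intro h
    have hδ (k : ℕ) : ((x * (b : ZMod p) ^ (k + m)).val : ℤ) - (x * (b : ZMod p) ^ k).val =
        b ^ k * (((x * (b : ZMod p) ^ m).val : ℤ) - x.val) := by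
      induction k with
      | zero => simp
      | succ k ih =>
        have h1 := key k
        have h2 := key (k + m)
        rw [h k] at h2
        rw [show k + 1 + m = k + m + 1 by ring, pow_succ' (b : ℤ), mul_assoc, ← ih]
        zify at h1 h2
        linarith
    have hz : ((x * (b : ZMod p) ^ m).val : ℤ) - x.val = 0 := by
      by_contra hne
      -- Looking at k = p is enough, because b^p > p.
      have h1 := hδ p
      have h2 : (p : ℤ) < b ^ p := by
        exact_mod_cast (Nat.lt_pow_self (by omega))
      have h3 : (1 : ℤ) ≤ |((x * (b : ZMod p) ^ m).val : ℤ) - x.val| := Int.one_le_abs hne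
      have h4 : |((x * (b : ZMod p) ^ (p + m)).val : ℤ) - (x * (b : ZMod p) ^ p).val| < p := by
        have := ZMod.val_lt (x * (b : ZMod p) ^ (p + m))
        have := ZMod.val_lt (x * (b : ZMod p) ^ p)
        rw [abs_lt]
        constructor <;> omega
      rw [h1, abs_mul, abs_of_nonneg (by positivity)] at h4
      nlinarith
    have h5 : x * (b : ZMod p) ^ m = x := ZMod.val_injective p (by omega)
    exact mul_left_cancel₀ hx0 (by rw [h5, mul_one])
  · intro h k
    have h1 := key k
    have h2 := key (k + m)
    rw [show k + m + 1 = k + 1 + m by ring, pow_add _ (k + 1) m, pow_add _ k m, h, mul_one, mul_one,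
      ← h1] at h2
    exact Nat.eq_of_mul_eq_mul_left hp (by omega)

theorem mul_sum_periodDigit (j d : ℕ) (hd : (b : ZMod p) ^ d = 1) :
    (p : ℚ) * ∑ k ∈ range d, (periodDigit p b g j k : ℚ) =
      ((b : ℚ) - 1) * ∑ k ∈ range d, (((g : ZMod p) ^ (2 * j) * (b : ZMod p) ^ k).val : ℚ) := by
  have key (k : ℕ) : (p : ℚ) * (periodDigit p b g j k : ℚ) =
      ((b : ℚ) - 1) * (((g : ZMod p) ^ (2 * j) * (b : ZMod p) ^ k).val : ℚ) -
      ((((g : ZMod p) ^ (2 * j) * (b : ZMod p) ^ (k + 1)).val : ℚ) -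
        (((g : ZMod p) ^ (2 * j) * (b : ZMod p) ^ k).val : ℚ)) := by
    have := mul_periodDigit_add_val p b g j k
    have : (p : ℚ) * (periodDigit p b g j k : ℚ) +
      (((g : ZMod p) ^ (2 * j) * (b : ZMod p) ^ (k + 1)).val : ℚ) =
      b * (((g : ZMod p) ^ (2 * j) * (b : ZMod p) ^ k).val : ℚ) := by exact_mod_cast this
    linarith
  rw [mul_sum, sum_congr rfl fun k _ ↦ key k, sum_sub_distrib, ← mul_sum,
    sum_range_sub (fun k ↦ (((g : ZMod p) ^ (2 * j) * (b : ZMod p) ^ k).val : ℚ)), hd]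
  simp

end Periods

/-! ### Sums over the quadratic residues -/

theorem quadraticChar_sq_add_self {F : Type*} [Field F] [Fintype F] [DecidableEq F] (x : F) :
    quadraticChar F x ^ 2 + quadraticChar F x = if quadraticChar F x = 1 then 2 else 0 := by
  by_cases hx : x = 0
  · simp [hx]
  · rcases quadraticChar_dichotomy hx with h | h <;> simp [h]

theorem two_mul_card_quadraticChar_eq_one (p : ℕ) [Fact p.Prime] (hp : p ≠ 2) :
    2 * #{x : ZMod p | quadraticChar (ZMod p) x = 1} = p - 1 := by
  have hp1 : 1 ≤ p := (Fact.out : p.Prime).one_le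
  have h1 : ∑ x : ZMod p, (quadraticChar (ZMod p) x ^ 2 + quadraticChar (ZMod p) x) =
      2 * (#{x : ZMod p | quadraticChar (ZMod p) x = 1} : ℤ) := by
    simp_rw [quadraticChar_sq_add_self, ← sum_filter, sum_const, nsmul_eq_mul, mul_comm]
  rw [sum_add_distrib, quadraticChar_sum_zero (by rwa [ZMod.ringChar_zmod_n])] at h1
  have h2 : ∑ x : ZMod p, quadraticChar (ZMod p) x ^ 2 = (p : ℤ) - 1 := by
    rw [← sum_erase_add _ _ (mem_univ 0), sum_congr rfl (g := fun _ ↦ 1)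
      fun x hx ↦ quadraticChar_sq_one (ne_of_mem_erase hx)]
    simp [card_erase_of_mem, hp1]
  omega

theorem two_mul_sum_val_quadraticChar_eq_one (p : ℕ) [Fact p.Prime] :
    2 * ∑ x : ZMod p with quadraticChar (ZMod p) x = 1, (x.val : ℤ) =
      ∑ x : ZMod p, (x.val : ℤ) + ∑ x : ZMod p, quadraticChar (ZMod p) x * x.val := by
  rw [← sum_add_distrib, sum_filter, mul_sum]
  refine sum_congr rfl fun x _ ↦ ?_
  by_cases hx : x = 0
  · simp [hx]
  · rcases quadraticChar_dichotomy hx with h | h <;> simp [h]; ring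

theorem ZMod.sum_val_eq_sum_range (n : ℕ) [NeZero n] {M : Type*} [AddCommMonoid M] (f : ℕ → M) :
    ∑ x : ZMod n, f x.val = ∑ i ∈ range n, f i := by
  refine sum_bij (fun x _ ↦ x.val) (fun x _ ↦ mem_range.2 (ZMod.val_lt x))
    (fun x _ y _ h ↦ ZMod.val_injective n h) (fun i hi ↦ ⟨(i : ZMod n), mem_univ _, ?_⟩)
    (fun _ _ ↦ rfl)
  exact ZMod.val_cast_of_lt (mem_range.1 hi)

theorem orderOf_dvd_of_legendreSym_eq_one (p : ℕ) [Fact p.Prime] {b : ℕ}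
    (hbres : legendreSym p (b : ℤ) = 1) : orderOf (b : ZMod p) ∣ p / 2 := by
  rw [orderOf_dvd_iff_pow_eq_one]
  have := legendreSym.eq_pow p b
  rw [hbres] at this
  simpa using this.symm

/-- The products `g ^ (2 * j) * b ^ k` run through the nonzero squares exactly once. -/
theorem sum_sum_pow_mul_pow (p : ℕ) [Fact p.Prime] (hp2 : p ≠ 2) (g : ZMod p)
    (hg : IsPrimitiveRoot g (p - 1)) (b : ℕ) (hbres : legendreSym p (b : ℤ) = 1)
    {M : Type*} [AddCommMonoid M] (f : ZMod p → M) :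
    ∑ j ∈ range ((p - 1) / (2 * orderOf (b : ZMod p))), ∑ k ∈ range (orderOf (b : ZMod p)),
        f (g ^ (2 * j) * (b : ZMod p) ^ k) =
      ∑ x with quadraticChar (ZMod p) x = 1, f x := by
  have hp : p.Prime := Fact.out
  have hodd : p % 2 = 1 := hp.eq_two_or_odd.resolve_left hp2
  set d := orderOf (b : ZMod p) with hd
  obtain ⟨n, hn⟩ := orderOf_dvd_of_legendreSym_eq_one p hbres
  rw [← hd] at hn
  have hpd : p - 1 = 2 * d * n := by rw [mul_assoc, ← hn]; omega
  have hp1 : 0 < p - 1 := by have := hp.two_le; omega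
  have hd0 : 0 < d := by
    rcases Nat.eq_zero_or_pos d with h | h
    · simp [h] at hpd; omega
    · exact h
  have hdiv : (p - 1) / (2 * d) = n := by rw [hpd, Nat.mul_div_cancel_left _ (by omega)]
  rw [hdiv, ← sum_product']
  have hg0 : g ≠ 0 := hg.ne_zero hp1.ne'
  have hb0 : (b : ZMod p) ≠ 0 := by
    intro h
    have := (legendreSym.eq_zero_iff p (b : ℤ)).2 (by simpa using h)
    omega
  have hinj : Set.InjOn (fun q : ℕ × ℕ ↦ g ^ (2 * q.1) * (b : ZMod p) ^ q.2)
      (range n ×ˢ range d : Finset (ℕ × ℕ)) := by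
    rintro ⟨j, k⟩ h1 ⟨j', k'⟩ h2 h
    simp only [coe_product, coe_range, Set.mem_prod, Set.mem_Iio] at h1 h2 h
    have hbd : (b : ZMod p) ^ d = 1 := pow_orderOf_eq_one _
    -- Raising to the power d removes the b-part; the remaining exponents 2jd stay below p - 1, the
    -- order of g.
    have h3 : g ^ (2 * j * d) = g ^ (2 * j' * d) := by
      have := congrArg (· ^ d) h
      simpa only [mul_pow, ← pow_mul, mul_comm k d, mul_comm k' d, pow_mul _ d, hbd, one_pow,
        mul_one] using this
    have hjj : j = j' := by
      have h4 (i : ℕ) (hi : i < n) : 2 * i * d < p - 1 := by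
        rw [hpd]
        nlinarith
      have := hg.pow_inj (h4 j h1.1) (h4 j' h2.1) h3
      have := Nat.eq_of_mul_eq_mul_right hd0 this
      omega
    subst hjj
    rw [(IsPrimitiveRoot.orderOf (b : ZMod p)).pow_inj h1.2 h2.2
      (mul_left_cancel₀ (pow_ne_zero _ hg0) h)]
  rw [← sum_image (f := f) hinj]
  -- Surjectivity comes from counting: n d = (p-1)/2 distinct squares are all of them.
  refine sum_congr (eq_of_subset_of_card_le ?_ ?_) fun _ _ ↦ rfl
  · intro x hx
    obtain ⟨⟨j, k⟩, -, rfl⟩ := mem_image.1 hx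
    have hb' : quadraticChar (ZMod p) (b : ZMod p) = 1 := by
      simpa [legendreSym] using hbres
    simp only [mem_filter, mem_univ, true_and, map_mul, map_pow, hb', one_pow, mul_one, pow_mul]
    rw [quadraticChar_sq_one hg0, one_pow]
  · rw [card_image_of_injOn hinj, card_product, card_range, card_range]
    have := two_mul_card_quadraticChar_eq_one p hp2
    nlinarith

end

/-! ### The sign of the quadratic Gauss sum -/

section

open Finset

namespace Polynomial

/-- The Euler operator `X * d/dX`. -/
noncomputable def eulerOp (R : Type*) [CommRing R] : R[X] →ₗ[R] R[X] :=
  (LinearMap.mulLeft R (X : R[X])).comp derivative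

variable {R : Type*} [CommRing R]

theorem eulerOp_apply (f : R[X]) : eulerOp R f = X * derivative f := rfl

theorem eulerOp_pow_C_mul_X_pow (m : ℕ) (c : R) (j : ℕ) :
    (eulerOp R ^ m) (C c * X ^ j) = C (c * (j : R) ^ m) * X ^ j := by
  induction m with
  | zero => simp
  | succ m ih =>
    rw [pow_succ', Module.End.mul_apply, ih, eulerOp_apply, derivative_C_mul_X_pow]
    rcases j with _ | j
    · simp
    · simp only [Nat.add_sub_cancel, map_mul, map_pow, pow_succ]
      ring

/-- Each application of the Euler operator lowers the order of vanishing at 1 by one, so only the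
leading coefficient survives. Unlike the plain derivative, this operator is diagonal on monomials
and produces j^m, which matches Euler's criterion. -/
theorem eval_one_eulerOp_pow (m : ℕ) (q : R[X]) :
    ((eulerOp R ^ m) ((X - 1) ^ m * q)).eval 1 = (m.factorial : R) * q.eval 1 := by
  induction m generalizing q with
  | zero => simp
  | succ m ih =>
    have h : eulerOp R ((X - 1) ^ (m + 1) * q) =
        (X - 1) ^ m * (((m + 1 : ℕ) : R[X]) * X * q + (X - 1) * X * derivative q) := by
      rw [eulerOp_apply, derivative_mul, derivative_pow]
      simp only [derivative_sub, derivative_X, derivative_one, Nat.add_sub_cancel, C_eq_natCast]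
      push_cast
      ring
    rw [pow_succ, Module.End.mul_apply, h, ih]
    simp [Nat.factorial_succ]
    ring

theorem eval_one_prod_geom_sum (m : ℕ) :
    (∏ a ∈ range m, ∑ i ∈ range (a + 1), (X : R[X]) ^ i).eval 1 = (m.factorial : R) := by
  rw [eval_prod, ← prod_range_add_one_eq_factorial, Nat.cast_prod]
  simp [eval_finsetSum]

end Polynomial

open Polynomial in
theorem IsPrimitiveRoot.prod_norm_one_sub_pow {p : ℕ} (hp : 0 < p) {ζ : ℂ}
    (hζ : IsPrimitiveRoot ζ p) : ∏ i ∈ range (p - 1), ‖1 - ζ ^ (i + 1)‖ = p := by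
  obtain ⟨n, rfl⟩ : ∃ n, p = n + 1 := ⟨p - 1, by omega⟩
  have h := X_pow_sub_C_eq_prod hζ hp (one_pow (M := ℂ) (n + 1))
  rw [prod_range_succ', C_1, ← mul_geom_sum, mul_comm] at h
  simp only [mul_one, pow_zero, C_1] at h
  have h2 := mul_right_cancel₀ (X_sub_C_ne_zero (1 : ℂ)) h
  have h3 := congrArg (fun f ↦ ‖eval 1 f‖) h2
  simp only [eval_finsetSum, eval_pow, eval_X, one_pow, sum_const, card_range, eval_prod, eval_sub,
    eval_C, norm_prod, nsmul_eq_mul, mul_one, Complex.norm_natCast] at h3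
  simpa using h3.symm

namespace QuadraticGaussSum

variable {p : ℕ}

/-- The half product `∏ ζ ^ (a * m) * (ζ ^ a - 1)`, `1 ≤ a ≤ m`. -/
noncomputable def halfProd (ζ : ℂ) (m : ℕ) : ℂ :=
  ∏ a ∈ range m, (ζ ^ ((a + 1) * m) * (ζ ^ (a + 1) - 1))

/-- The factors 1 - ζ^a and 1 - ζ^(p-a) have equal absolute value, so the half product carries the
square root of ∏ |1 - ζ^i| = p. -/
theorem norm_halfProd_sq {m : ℕ} (hm : p = 2 * m + 1) {ζ : ℂ} (hζ : IsPrimitiveRoot ζ p) :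
    ‖halfProd ζ m‖ ^ 2 = p := by
  have hp0 : p ≠ 0 := by omega
  have h1 : ‖ζ‖ = 1 := hζ.norm'_eq_one hp0
  rw [← hζ.prod_norm_one_sub_pow (by omega), show p - 1 = m + m by omega, prod_range_add,
    ← prod_range_reflect (fun x ↦ ‖1 - ζ ^ (m + x + 1)‖), ← prod_mul_distrib, halfProd, norm_prod,
    ← prod_pow]
  refine prod_congr rfl fun a ha ↦ ?_
  rw [mem_range] at ha
  have h2 : ‖1 - ζ ^ (m + (m - 1 - a) + 1)‖ = ‖ζ ^ (a + 1) - 1‖ := by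
    have : ζ ^ (a + 1) * (1 - ζ ^ (m + (m - 1 - a) + 1)) = ζ ^ (a + 1) - 1 := by
      rw [mul_sub, ← pow_add, show a + 1 + (m + (m - 1 - a) + 1) = p by omega, hζ.pow_eq_one,
        mul_one]
    rw [← this, norm_mul, norm_pow, h1, one_pow, one_mul]
  rw [h2, norm_mul, norm_pow, h1, one_pow, one_mul, norm_sub_rev, sq]

/-- As 2m = p - 1, the power ζ^(am) equals (-1)^a exp(-πia/p), and this symmetrises ζ^a - 1 into a
sine. -/
theorem halfProd_exp_factor {m : ℕ} (hm : p = 2 * m + 1) (a : ℕ) :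
    Complex.exp (2 * Real.pi * Complex.I / p) ^ (a * m) *
      (Complex.exp (2 * Real.pi * Complex.I / p) ^ a - 1) =
    (-1) ^ a * (2 * Complex.I) * (Real.sin (Real.pi * a / p) : ℝ) := by
  have hp0 : (p : ℂ) ≠ 0 := by exact_mod_cast (by omega : p ≠ 0)
  have hmc : (p : ℂ) = 2 * m + 1 := by exact_mod_cast hm
  push_cast
  rw [Complex.sin, ← Complex.exp_pi_mul_I, ← Complex.exp_nat_mul, ← Complex.exp_nat_mul,
    ← Complex.exp_nat_mul]
  have e1 : ((a * m : ℕ) : ℂ) * (2 * Real.pi * Complex.I / p) =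
      (a : ℂ) * (Real.pi * Complex.I) + -(Real.pi * a / p) * Complex.I := by
    push_cast
    field_simp
    rw [hmc]
    ring
  have e2 : (a : ℂ) * (2 * Real.pi * Complex.I / p) =
      (Real.pi * a / p) * Complex.I + (Real.pi * a / p) * Complex.I := by ring
  rw [e1, e2, Complex.exp_add, Complex.exp_add]
  have e3 : Complex.exp (-(Real.pi * a / p) * Complex.I) *
      Complex.exp ((Real.pi * a / p) * Complex.I) = 1 := by
    rw [← Complex.exp_add]; simp
  set E := Complex.exp ((Real.pi * a / p) * Complex.I)
  set E' := Complex.exp (-(Real.pi * a / p) * Complex.I)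
  set S := Complex.exp ((a : ℂ) * (Real.pi * Complex.I))
  linear_combination S * E * e3 + (S * (E - E')) * Complex.I_sq

theorem neg_one_pow_sum_mul_I_pow (q : ℕ) :
    (∏ a ∈ range (2 * q + 1), ((-1 : ℂ) ^ (a + 1) * Complex.I)) = -Complex.I := by
  induction q with
  | zero => simp
  | succ q ih =>
    rw [show 2 * (q + 1) + 1 = 2 * q + 1 + 1 + 1 by ring, prod_range_succ, prod_range_succ, ih]
    have h : ((-1 : ℂ) ^ (2 * q + 1 + 1 + 1)) = -1 := Odd.neg_one_pow ⟨q + 1, by ring⟩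
    have h' : ((-1 : ℂ) ^ (2 * q + 1 + 1)) = 1 := Even.neg_one_pow ⟨q + 1, by ring⟩
    rw [h, h']
    linear_combination Complex.I * Complex.I_sq

/-- All the sines are positive, so the modulus is known from `norm_halfProd_sq` and the phase is the
product of the (-1)^a i, which is -i for every odd m. -/
theorem halfProd_exp [Fact p.Prime] {m : ℕ} (hm : p = 2 * m + 1) (hodd : Odd m) :
    halfProd (Complex.exp (2 * Real.pi * Complex.I / p)) m = -(Complex.I * (Real.sqrt p : ℝ)) := by
  have hp0 : p ≠ 0 := by omega
  have hppos : (0 : ℝ) < p := by exact_mod_cast Nat.pos_of_ne_zero hp0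
  have hζ := Complex.isPrimitiveRoot_exp p hp0
  obtain ⟨q, hq⟩ := hodd
  set T : ℝ := ∏ a ∈ range m, (2 * Real.sin (Real.pi * (a + 1 : ℕ) / p)) with hT
  have hTpos : 0 < T := by
    refine prod_pos fun a ha ↦ mul_pos two_pos (Real.sin_pos_of_pos_of_lt_pi ?_ ?_)
    · positivity
    · rw [mem_range] at ha
      rw [div_lt_iff₀ hppos]
      refine mul_lt_mul_of_pos_left ?_ Real.pi_pos
      exact_mod_cast (by omega : a + 1 < p)
  have hD : halfProd (Complex.exp (2 * Real.pi * Complex.I / p)) m = -(Complex.I * (T : ℝ)) := by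
    rw [halfProd, prod_congr rfl fun a _ ↦ halfProd_exp_factor hm (a + 1), hT, ← neg_mul,
      ← neg_one_pow_sum_mul_I_pow q, ← hq, Complex.ofReal_prod, ← prod_mul_distrib]
    refine prod_congr rfl fun a _ ↦ ?_
    push_cast
    ring
  have hn := norm_halfProd_sq hm hζ
  rw [hD, norm_neg, norm_mul, Complex.norm_I, one_mul, Complex.norm_real, Real.norm_eq_abs,
    sq_abs] at hn
  rw [hD, ← hn, Real.sqrt_sq hTpos.le]

/-- Wilson's theorem, with the upper half m+1, ..., 2m of the factorial replaced by the negatives of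
1, ..., m. -/
theorem factorial_half_sq [Fact p.Prime] {m : ℕ} (hm : p = 2 * m + 1) (hodd : Odd m) :
    (m.factorial : ZMod p) ^ 2 = 1 := by
  have h := ZMod.wilsons_lemma p
  rw [show p - 1 = m + m by omega, ← prod_range_add_one_eq_factorial, prod_range_add] at h
  push_cast at h
  have h2 : ∏ x ∈ range m, ((m : ZMod p) + x + 1) = (-1) ^ m * (m.factorial : ZMod p) := by
    rw [← prod_range_reflect, ← prod_range_add_one_eq_factorial]
    push_cast
    rw [← card_range m, ← prod_const, card_range, ← prod_mul_distrib]
    refine prod_congr rfl fun a ha ↦ ?_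
    rw [mem_range] at ha
    have : ((m + (m - 1 - a) + 1 + (a + 1) : ℕ) : ZMod p) = 0 := by
      rw [show m + (m - 1 - a) + 1 + (a + 1) = p by omega]; simp
    push_cast at this ⊢
    linear_combination this
  rw [h2, hodd.neg_one_pow, ← prod_range_add_one_eq_factorial] at h
  rw [← prod_range_add_one_eq_factorial]
  push_cast at h ⊢
  linear_combination -h

-- Equality would make Φ_p = (X-1)^(p-1) divide modulo p the difference of the two polynomials.
-- Applying the Euler operator m times and setting X = 1 then gives 0 = Σ j^(2m) - (m!)^2 = -1 - 1
-- in ZMod p, which is impossible for odd p.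
open Polynomial in
theorem sum_legendreSym_mul_pow_ne_halfProd [Fact p.Prime] {m : ℕ} (hm : p = 2 * m + 1) (hodd : Odd m) {ζ : ℂ}
    (hζ : IsPrimitiveRoot ζ p) :
    ∑ j ∈ range p, (legendreSym p j : ℂ) * ζ ^ j ≠ halfProd ζ m := by
  intro heq
  have hp : p.Prime := Fact.out
  set f : ℤ[X] := ∑ j ∈ range p, C (legendreSym p j) * X ^ j -
    ∏ a ∈ range m, (X ^ ((a + 1) * m) * (X ^ (a + 1) - 1)) with hf
  have hroot : aeval ζ f = 0 := by
    simp only [hf, map_sub, map_sum, map_mul, map_prod, map_pow, aeval_X, map_one, eq_intCast,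
      map_intCast]
    rw [heq, halfProd, sub_self]
  have hdvd : cyclotomic p ℤ ∣ f := by
    rw [cyclotomic_eq_minpoly hζ hp.pos]
    exact minpoly.isIntegrallyClosed_dvd (hζ.isIntegral hp.pos) hroot
  have hdvd2 : (X - 1 : (ZMod p)[X]) ^ (m + 1) ∣ f.map (Int.castRingHom (ZMod p)) := by
    have h1 : cyclotomic p (ZMod p) = (X - 1) ^ (p - 1) := by
      have := cyclotomic_mul_prime_eq_pow_of_not_dvd (ZMod p) (p := p) (n := 1)
        (by simpa using hp.one_lt.ne')
      rwa [one_mul, cyclotomic_one] at this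
    have h2 := Polynomial.map_dvd (Int.castRingHom (ZMod p)) hdvd
    rw [map_cyclotomic, h1] at h2
    refine (pow_dvd_pow _ ?_).trans h2
    have := hp.two_le
    obtain ⟨q, hq⟩ := hodd
    omega
  obtain ⟨r, hr⟩ := hdvd2
  have h3 := congrArg (fun g ↦ eval 1 ((eulerOp (ZMod p) ^ m) g)) hr
  -- The factor X - 1 left over beyond the m-th power makes this side vanish at 1.
  rw [pow_succ, mul_assoc, eval_one_eulerOp_pow] at h3
  have h4 : f.map (Int.castRingHom (ZMod p)) =
      ∑ j ∈ range p, C ((j : ZMod p) ^ m) * X ^ j - (X - 1) ^ m *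
        ((∏ a ∈ range m, X ^ ((a + 1) * m)) * ∏ a ∈ range m, ∑ i ∈ range (a + 1), X ^ i) := by
    have hl (j : ℕ) : ((legendreSym p j : ℤ) : ZMod p) = (j : ZMod p) ^ m := by
      rw [legendreSym.eq_pow, show p / 2 = m by omega]; simp
    simp only [hf, Polynomial.map_sub, Polynomial.map_sum, Polynomial.map_mul, Polynomial.map_prod,
      Polynomial.map_pow, map_X, Polynomial.map_one, eq_intCast]
    congr 1
    · refine sum_congr rfl fun j _ ↦ ?_
      rw [Polynomial.map_intCast, ← hl, ← C_eq_intCast]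
    · rw [mul_left_comm, prod_mul_distrib]
      congr 1
      rw [← card_range m, ← prod_const, card_range, ← prod_mul_distrib]
      exact prod_congr rfl fun a _ ↦ (mul_geom_sum _ _).symm
  simp only [h4, map_sub, map_sum, eval_sub, eval_one_eulerOp_pow, eulerOp_pow_C_mul_X_pow] at h3
  rw [eval_mul, eval_one_prod_geom_sum] at h3
  have h5 : ∑ j ∈ range p, ((j : ZMod p) ^ m * (j : ZMod p) ^ m) = -1 := by
    obtain ⟨n, rfl⟩ : ∃ n, p = n + 1 := ⟨p - 1, by omega⟩
    have hm0 : m ≠ 0 := by have := hp.two_le; omega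
    rw [sum_range_succ']
    simp only [← pow_add, Nat.cast_zero]
    rw [zero_pow (by omega), add_zero, sum_congr rfl (g := fun _ ↦ 1)]
    · have : ((n + 1 : ℕ) : ZMod (n + 1)) = 0 := by simp
      push_cast at this
      simp
      linear_combination this
    · intro j hj
      rw [mem_range] at hj
      have hj0 : ((j + 1 : ℕ) : ZMod (n + 1)) ≠ 0 := by
        rw [Ne, ZMod.natCast_eq_zero_iff]
        exact Nat.not_dvd_of_pos_of_lt (by omega) (by omega)
      have := ZMod.pow_card_sub_one_eq_one hj0
      rwa [show n + 1 - 1 = m + m by omega] at this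
  have h6 := factorial_half_sq hm hodd
  simp [eval_finsetSum, eval_prod, h5] at h3
  have h7 : (2 : ZMod p) = 0 := by linear_combination -h3 - h6
  have h8 : ((2 : ℕ) : ZMod p) = 0 := by exact_mod_cast h7
  rw [ZMod.natCast_eq_zero_iff] at h8
  have := Nat.le_of_dvd two_pos h8
  have := hp.two_le
  omega

/-- The sign of the quadratic Gauss sum for primes `p ≡ 3 mod 4`. -/
theorem sum_quadraticChar_mul_stdAddChar [Fact p.Prime] (hp4 : p % 4 = 3) :
    ∑ j : ZMod p, (quadraticChar (ZMod p) j : ℂ) * ZMod.stdAddChar j =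
      Complex.I * (Real.sqrt p : ℝ) := by
  have hp : p.Prime := Fact.out
  have hm : p = 2 * (p / 2) + 1 := by omega
  have hodd : Odd (p / 2) := ⟨p / 4, by omega⟩
  have hζ := Complex.isPrimitiveRoot_exp p hp.ne_zero
  have hG : ∑ j : ZMod p, (quadraticChar (ZMod p) j : ℂ) * ZMod.stdAddChar j =
      ∑ j ∈ range p, (legendreSym p j : ℂ) * Complex.exp (2 * Real.pi * Complex.I / p) ^ j := by
    rw [← ZMod.sum_val_eq_sum_range]
    refine sum_congr rfl fun j _ ↦ ?_
    rw [ZMod.stdAddChar_apply, ZMod.toCircle_apply, ← Complex.exp_nat_mul, legendreSym]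
    congr 2
    · simp
    · ring
  have h2 : ringChar (ZMod p) ≠ 2 := by rw [ZMod.ringChar_zmod_n]; omega
  have hsq : (∑ j : ZMod p, (quadraticChar (ZMod p) j : ℂ) * ZMod.stdAddChar j) ^ 2 = -p := by
    have h := gaussSum_sq (χ := (quadraticChar (ZMod p)).ringHomComp (Int.castRingHom ℂ))
      (ψ := ZMod.stdAddChar) ?_ ((quadraticChar_isQuadratic _).comp _)
      (ZMod.isPrimitive_stdAddChar p)
    · rw [MulChar.ringHomComp_apply, quadraticChar_neg_one h2, ZMod.card,
        ZMod.χ₄_nat_three_mod_four hp4] at h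
      simpa [gaussSum] using h
    · exact (MulChar.ringHomComp_ne_one_iff Int.cast_injective).2 (quadraticChar_ne_one h2)
  have hD := halfProd_exp hm hodd
  have hne := sum_legendreSym_mul_pow_ne_halfProd hm hodd hζ
  rw [← hG, hD] at hne
  have hs : ((Real.sqrt p : ℝ) : ℂ) ^ 2 = p := by
    rw [← Complex.ofReal_pow, Real.sq_sqrt (Nat.cast_nonneg p)]; simp
  have : (∑ j : ZMod p, (quadraticChar (ZMod p) j : ℂ) * ZMod.stdAddChar j) ^ 2 =
      (Complex.I * (Real.sqrt p : ℝ)) ^ 2 := by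
    rw [hsq, mul_pow, Complex.I_sq, hs]; ring
  exact (sq_eq_sq_iff_eq_or_eq_neg.1 this).resolve_right hne

end QuadraticGaussSum

end

/-! ### L-series at s = 1 by summation by parts -/

section

open Finset Filter Topology

section AbelSummation

variable (F : ℕ → ℂ)

theorem sum_mul_eq_by_parts (w : ℕ → ℂ) (N : ℕ) :
    ∑ k ∈ range N, w k * F k = w N * ∑ k ∈ range N, F k +
      ∑ k ∈ range N, (w k - w (k + 1)) * ∑ i ∈ range (k + 1), F i := by
  induction N with
  | zero => simp
  | succ N ih =>
    rw [sum_range_succ, ih, sum_range_succ (fun k ↦ (w k - w (k + 1)) * _), sum_range_succ F N]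
    ring

/-- The bound is uniform for s in [1, 2]; this majorant lets the limit s → 1 pass inside the series
obtained by parts. -/
theorem rpow_neg_sub_rpow_neg_succ_le (k : ℕ) {s : ℝ} (h1 : 1 ≤ s) (h2 : s ≤ 2) :
    |((k + 1 : ℝ) ^ (-s) - (k + 1 + 1 : ℝ) ^ (-s))| ≤ 2 * (1 / ((k : ℝ) + 1) ^ 2) := by
  set x : ℝ := k + 1 with hx
  have hx1 : 1 ≤ x := by rw [hx]; linarith [Nat.cast_nonneg (α := ℝ) k]
  have hx0 : 0 < x := by linarith
  have hanti : (x + 1) ^ (-s) ≤ x ^ (-s) :=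
    Real.rpow_le_rpow_of_nonpos hx0 (by linarith) (by linarith)
  rw [abs_of_nonneg (by linarith)]
  have e1 : (x + 1) ^ (-s) = x ^ (-s) * (x / (x + 1)) ^ s := by
    rw [Real.div_rpow hx0.le (by linarith), Real.rpow_neg hx0.le, Real.rpow_neg (by linarith)]
    have := (Real.rpow_pos_of_pos hx0 s).ne'
    field_simp
  have e2 : (x / (x + 1)) ^ (2 : ℝ) ≤ (x / (x + 1)) ^ s :=
    Real.rpow_le_rpow_of_exponent_ge (by positivity) (by rw [div_le_one (by linarith)]; linarith) h2
  have e3 : x ^ (-s) ≤ x⁻¹ := by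
    rw [← Real.rpow_neg_one]
    exact Real.rpow_le_rpow_of_exponent_le hx1 (by linarith)
  have e4 : 0 ≤ x ^ (-s) := by positivity
  have e5 : 1 - (x / (x + 1)) ^ (2 : ℝ) ≤ 2 / x := by
    rw [Real.rpow_two, div_pow, sub_le_iff_le_add, div_add_div _ _ (by positivity) (by positivity),
      le_div_iff₀ (by positivity)]
    nlinarith
  have e6 : 0 ≤ 1 - (x / (x + 1)) ^ (2 : ℝ) := by
    rw [Real.rpow_two, sub_nonneg]
    exact pow_le_one₀ (by positivity) (by rw [div_le_one (by linarith)]; linarith)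
  calc x ^ (-s) - (x + 1) ^ (-s) = x ^ (-s) * (1 - (x / (x + 1)) ^ s) := by rw [e1]; ring
    _ ≤ x ^ (-s) * (1 - (x / (x + 1)) ^ (2 : ℝ)) := by gcongr
    _ ≤ x⁻¹ * (2 / x) := by gcongr
    _ = 2 * (1 / x ^ 2) := by field_simp

variable {F} {C : ℝ}

/-- The sum obtained from `∑ F k * (k + 1) ^ (-s)` by summation by parts. -/
noncomputable def byPartsSum (F : ℕ → ℂ) (s : ℝ) : ℂ :=
  ∑' k : ℕ, ((((k + 1 : ℝ) ^ (-s) - (k + 1 + 1 : ℝ) ^ (-s) : ℝ)) : ℂ) * ∑ i ∈ range (k + 1), F i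

theorem norm_byParts_term_le (hC : ∀ n, ‖∑ k ∈ range n, F k‖ ≤ C) (k : ℕ) {s : ℝ} (h1 : 1 ≤ s) (h2 : s ≤ 2) :
    ‖((((k + 1 : ℝ) ^ (-s) - (k + 1 + 1 : ℝ) ^ (-s) : ℝ)) : ℂ) * ∑ i ∈ range (k + 1), F i‖ ≤
      2 * (1 / ((k : ℝ) + 1) ^ 2) * C := by
  rw [norm_mul, Complex.norm_real, Real.norm_eq_abs]
  exact mul_le_mul (rpow_neg_sub_rpow_neg_succ_le k h1 h2) (hC _) (norm_nonneg _) (by positivity)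

theorem summable_byParts_bound (C : ℝ) :
    Summable fun k : ℕ ↦ 2 * (1 / ((k : ℝ) + 1) ^ 2) * C := by
  refine (Summable.mul_left _ ?_).mul_right _
  exact_mod_cast (summable_nat_add_iff 1).2 (Real.summable_one_div_nat_pow.2 one_lt_two)

theorem tendsto_sum_byPartsSum (hC : ∀ n, ‖∑ k ∈ range n, F k‖ ≤ C)
    {s : ℝ} (h1 : 1 ≤ s) (h2 : s ≤ 2) :
    Tendsto (fun N ↦ ∑ k ∈ range N, (((k + 1 : ℝ) ^ (-s) : ℝ) : ℂ) * F k) atTop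
      (𝓝 (byPartsSum F s)) := by
  have hw := sum_mul_eq_by_parts F (fun k ↦ (((k + 1 : ℝ) ^ (-s) : ℝ) : ℂ))
  simp_rw [hw]
  rw [← zero_add (byPartsSum F s)]
  refine Tendsto.add ?_ ?_
  · refine squeeze_zero_norm (a := fun N : ℕ ↦ (N + 1 : ℝ) ^ (-s) * C) (fun N ↦ ?_) ?_
    · rw [norm_mul, Complex.norm_real, Real.norm_of_nonneg (by positivity)]
      gcongr
      exact hC N
    · rw [← zero_mul C]
      refine Tendsto.mul_const _ ?_
      have h3 := (tendsto_rpow_neg_atTop (by linarith : 0 < s)).comp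
        (tendsto_natCast_atTop_atTop (R := ℝ))
      have h4 := h3.comp (tendsto_add_atTop_nat 1)
      refine h4.congr fun N ↦ ?_
      simp
  · have hs : Summable fun k : ℕ ↦
        ((((k + 1 : ℝ) ^ (-s) - (k + 1 + 1 : ℝ) ^ (-s) : ℝ)) : ℂ) * ∑ i ∈ range (k + 1), F i :=
      Summable.of_norm_bounded (summable_byParts_bound C) fun k ↦ norm_byParts_term_le hC k h1 h2
    refine hs.hasSum.tendsto_sum_nat.congr fun N ↦ sum_congr rfl fun k _ ↦ ?_
    push_cast
    ring

theorem tendsto_byPartsSum (hC : ∀ n, ‖∑ k ∈ range n, F k‖ ≤ C) :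
    Tendsto (byPartsSum F) (𝓝[>] 1) (𝓝 (byPartsSum F 1)) := by
  refine tendsto_tsum_of_dominated_convergence (summable_byParts_bound C) (fun k ↦ ?_) ?_
  · refine Tendsto.mul_const _ (Tendsto.mono_left ?_ nhdsWithin_le_nhds)
    refine (Complex.continuous_ofReal.tendsto _).comp (Tendsto.sub ?_ ?_)
    · exact (Real.continuousAt_const_rpow (by positivity)).tendsto.comp (continuous_neg.tendsto 1)
    · exact (Real.continuousAt_const_rpow (by positivity)).tendsto.comp (continuous_neg.tendsto 1)
  · filter_upwards [Ioo_mem_nhdsGT (one_lt_two (α := ℝ))] with s hs k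
    exact norm_byParts_term_le hC k hs.1.le hs.2.le

theorem LSeries_eq_byPartsSum {f : ℕ → ℂ} (hC : ∀ n, ‖∑ k ∈ range n, f (k + 1)‖ ≤ C)
    {s : ℝ} (h1 : 1 < s) (h2 : s ≤ 2) (hs : LSeriesSummable f s) :
    LSeries f s = byPartsSum (fun k ↦ f (k + 1)) s := by
  have h3 := ((hasSum_nat_add_iff' 1).2 hs.hasSum).tendsto_sum_nat
  rw [range_one, sum_singleton, LSeries.term_zero, sub_zero] at h3
  refine tendsto_nhds_unique (h3.congr fun N ↦ sum_congr rfl fun k _ ↦ ?_)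
    (tendsto_sum_byPartsSum hC h1.le h2)
  rw [LSeries.term_of_ne_zero (by omega), Real.rpow_neg (by positivity), Complex.ofReal_inv,
    Complex.ofReal_cpow (by positivity), div_eq_inv_mul]
  push_cast
  rfl

/-- An `L`-series whose coefficients have bounded partial sums tends, for `s → 1`, to the Abel
limit of `∑ f n / n`. -/
theorem tendsto_LSeries_of_tendsto_powerSeries {f : ℕ → ℂ}
    (hC : ∀ n, ‖∑ k ∈ range n, f (k + 1)‖ ≤ C)
    (hs : ∀ s : ℝ, 1 < s → LSeriesSummable f s) {l : ℂ}
    (hl : Tendsto (fun x : ℝ ↦ ∑' n : ℕ, f n / n * (x : ℂ) ^ n) (𝓝[<] 1) (𝓝 l)) :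
    Tendsto (fun s : ℝ ↦ LSeries f s) (𝓝[>] 1) (𝓝 l) := by
  have h1 : Tendsto (fun N ↦ ∑ n ∈ range N, f n / n) atTop
      (𝓝 (byPartsSum (fun k ↦ f (k + 1)) 1)) := by
    rw [← tendsto_add_atTop_iff_nat 1]
    refine (tendsto_sum_byPartsSum hC le_rfl one_le_two).congr fun N ↦ ?_
    rw [sum_range_succ']
    simp only [Nat.cast_zero, div_zero, add_zero]
    refine sum_congr rfl fun k _ ↦ ?_
    rw [Real.rpow_neg_one, div_eq_inv_mul]
    push_cast
    rfl
  -- Abel's limit theorem identifies the sum of the series at s = 1 with the limit l of the power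
  -- series.
  have h2 := tendsto_map'_iff.1 (Complex.tendsto_tsum_powerSeries_nhdsWithin_lt h1)
  rw [tendsto_nhds_unique hl h2]
  refine (tendsto_byPartsSum hC).congr' ?_
  filter_upwards [Ioo_mem_nhdsGT (one_lt_two (α := ℝ))] with s h
  exact (LSeries_eq_byPartsSum hC h.1 h.2.le (hs s h.1)).symm

end AbelSummation

/-! ### The value of L(1, χ) -/

theorem Complex.log_one_sub_exp {θ : ℝ} (h0 : 0 < θ) (h1 : θ < 2 * Real.pi) :
    Complex.log (1 - Complex.exp (θ * Complex.I)) =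
      Real.log ‖1 - Complex.exp (θ * Complex.I)‖ + ((θ - Real.pi) / 2 : ℝ) * Complex.I := by
  have hs : 0 < Real.sin (θ / 2) := Real.sin_pos_of_pos_of_lt_pi (by linarith) (by linarith)
  -- Polar form: the radius is positive and the angle (θ - π)/2 lies strictly between -π/2 and π/2,
  -- so the principal logarithm reads it off.
  have key : 1 - Complex.exp (θ * Complex.I) =
      ((2 * Real.sin (θ / 2) : ℝ) : ℂ) * Complex.exp (((θ - Real.pi) / 2 : ℝ) * Complex.I) := by
    have e1 : (((θ - Real.pi) / 2 : ℝ) : ℂ) * Complex.I =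
        (θ / 2 : ℝ) * Complex.I + -(Real.pi / 2 * Complex.I) := by push_cast; ring
    have e2 : (θ : ℂ) * Complex.I = (θ / 2 : ℝ) * Complex.I + (θ / 2 : ℝ) * Complex.I := by
      push_cast; ring
    rw [e1, e2, Complex.exp_add, Complex.exp_add, Complex.exp_neg, Complex.exp_pi_div_two_mul_I,
      Complex.exp_mul_I, ← Complex.ofReal_cos, ← Complex.ofReal_sin, Complex.inv_I]
    have h : (Real.cos (θ / 2) : ℂ) ^ 2 + (Real.sin (θ / 2) : ℂ) ^ 2 = 1 := by
      exact_mod_cast Real.cos_sq_add_sin_sq (θ / 2)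
    push_cast at h ⊢
    linear_combination -h + (Complex.sin (θ / 2)) ^ 2 * Complex.I_sq
  have hn : ‖1 - Complex.exp (θ * Complex.I)‖ = 2 * Real.sin (θ / 2) := by
    rw [key, norm_mul, Complex.norm_exp_ofReal_mul_I, mul_one, Complex.norm_real,
      Real.norm_of_nonneg (by positivity)]
  have him : ((((θ - Real.pi) / 2 : ℝ) : ℂ) * Complex.I).im = (θ - Real.pi) / 2 := by
    rw [Complex.im_ofReal_mul, Complex.I_im, mul_one]
  rw [hn, key, Complex.log_ofReal_mul (by positivity) (Complex.exp_ne_zero _), Complex.log_exp]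
  · rw [him]; linarith
  · rw [him]; linarith

theorem MulChar.isOdd_quadraticChar_zmod (p : ℕ) [Fact p.Prime] (hp4 : p % 4 = 3) (a : ZMod p) :
    quadraticChar (ZMod p) (-a) = -quadraticChar (ZMod p) a := by
  have h2 : ringChar (ZMod p) ≠ 2 := by rw [ZMod.ringChar_zmod_n]; omega
  rw [← neg_one_mul, map_mul, quadraticChar_neg_one h2, ZMod.card,
    ZMod.χ₄_nat_three_mod_four hp4, neg_one_mul]

section LOne

variable (p : ℕ) [Fact p.Prime]

/-- The sum of χ over a full period vanishes, so the partial sums are p-periodic and fewer than p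
terms matter. -/
theorem norm_sum_quadraticChar_le (hp2 : p ≠ 2) (n : ℕ) :
    ‖∑ k ∈ range n, (quadraticChar (ZMod p) ((k + 1 : ℕ) : ZMod p) : ℂ)‖ ≤ p := by
  set B : ℕ → ℂ := fun n ↦ ∑ k ∈ range n, (quadraticChar (ZMod p) ((k + 1 : ℕ) : ZMod p) : ℂ)
  have hB : Function.Periodic B p := by
    intro n
    induction n with
    | zero =>
      have h : ∑ k ∈ range (p + 1), (quadraticChar (ZMod p) (k : ZMod p) : ℂ) = 0 := by
        rw [sum_range_succ, ← ZMod.sum_val_eq_sum_range p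
          (fun k ↦ (quadraticChar (ZMod p) (k : ZMod p) : ℂ))]
        have := quadraticChar_sum_zero (F := ZMod p) (by rwa [ZMod.ringChar_zmod_n])
        simp only [ZMod.natCast_val, ZMod.cast_id', id_eq, CharP.cast_eq_zero, MulChar.map_zero,
          Int.cast_zero, add_zero]
        exact_mod_cast this
      rw [sum_range_succ'] at h
      simpa [B] using h
    | succ n ih =>
      have e (n : ℕ) : B (n + 1) = B n + (quadraticChar (ZMod p) ((n + 1 : ℕ) : ZMod p) : ℂ) :=
        sum_range_succ _ _
      rw [show n + 1 + p = n + p + 1 by ring, e, e, ih]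
      simp
  change ‖B n‖ ≤ p
  rw [← hB.map_mod_nat n]
  calc ‖B (n % p)‖ ≤ ∑ k ∈ range (n % p),
        ‖(quadraticChar (ZMod p) ((k + 1 : ℕ) : ZMod p) : ℂ)‖ := norm_sum_le _ _
    _ ≤ ∑ k ∈ range (n % p), 1 := by
      refine sum_le_sum fun k _ ↦ ?_
      rcases quadraticChar_isQuadratic (ZMod p) ((k + 1 : ℕ) : ZMod p) with h | h | h <;>
        rw [h] <;> simp
    _ ≤ p := by
      simp only [sum_const, card_range, nsmul_eq_mul, mul_one]
      exact_mod_cast (Nat.mod_lt _ (Fact.out : p.Prime).pos).le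

theorem LSeriesSummable_quadraticChar {s : ℝ} (hs : 1 < s) :
    LSeriesSummable (fun n ↦ (quadraticChar (ZMod p) (n : ZMod p) : ℂ)) s := by
  refine LSeriesSummable_of_bounded_of_one_lt_re (m := 1) (fun n _ ↦ ?_) (by simpa using hs)
  rcases quadraticChar_isQuadratic (ZMod p) (n : ZMod p) with h | h | h <;> rw [h] <;> simp

/-- Substituting a ↦ na in the Gauss sum pulls out χ(n); when p divides n both sides vanish. -/
theorem I_mul_sqrt_mul_quadraticChar (hp4 : p % 4 = 3) (n : ℕ) :
    Complex.I * (Real.sqrt p : ℝ) * (quadraticChar (ZMod p) (n : ZMod p) : ℂ) =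
      ∑ a : ZMod p, (quadraticChar (ZMod p) a : ℂ) * ZMod.stdAddChar a ^ n := by
  rw [← QuadraticGaussSum.sum_quadraticChar_mul_stdAddChar hp4]
  have hsm (a : ZMod p) : ZMod.stdAddChar a ^ n = ZMod.stdAddChar ((n : ZMod p) * a) := by
    rw [← AddChar.map_nsmul_eq_pow, nsmul_eq_mul]
  simp_rw [hsm]
  by_cases hn : (n : ZMod p) = 0
  · have := quadraticChar_sum_zero (F := ZMod p) (by rw [ZMod.ringChar_zmod_n]; omega)
    simp only [hn, MulChar.map_zero, Int.cast_zero, mul_zero, zero_mul, AddChar.map_zero_eq_one,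
      mul_one]
    exact_mod_cast this.symm
  · rw [← Equiv.sum_comp (Equiv.mulLeft₀ (n : ZMod p) hn), sum_mul]
    refine sum_congr rfl fun a _ ↦ ?_
    simp only [Equiv.mulLeft₀_apply, map_mul, Int.cast_mul]
    have : (quadraticChar (ZMod p) (n : ZMod p) : ℂ) ^ 2 = 1 := by
      exact_mod_cast quadraticChar_sq_one hn
    linear_combination (quadraticChar (ZMod p) a : ℂ) * ZMod.stdAddChar ((n : ZMod p) * a) * this

/-- Since χ is odd and |1 - ζ^a| is even in a, the real parts of the logarithms cancel. The constant
part -π/2 of the arguments dies because Σ χ(a) = 0. -/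
theorem sum_quadraticChar_mul_log (hp4 : p % 4 = 3) :
    ∑ a : ZMod p, (quadraticChar (ZMod p) a : ℂ) * Complex.log (1 - ZMod.stdAddChar a) =
      Complex.I * (Real.pi / p) * ((∑ a : ZMod p, quadraticChar (ZMod p) a * (a.val : ℤ) : ℤ) : ℂ) := by
  have hp : p.Prime := Fact.out
  have hp0 : (p : ℂ) ≠ 0 := by exact_mod_cast hp.ne_zero
  have hlog (a : ZMod p) (ha : a ≠ 0) : Complex.log (1 - ZMod.stdAddChar a) =
      Real.log ‖1 - ZMod.stdAddChar a‖ +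
        (Real.pi / p * a.val - Real.pi / 2) * Complex.I := by
    have e : ZMod.stdAddChar a = Complex.exp ((2 * Real.pi * a.val / p : ℝ) * Complex.I) := by
      rw [ZMod.stdAddChar_apply, ZMod.toCircle_apply]
      congr 1
      push_cast
      ring
    have hv : 0 < a.val := Nat.pos_of_ne_zero ((ZMod.val_ne_zero a).2 ha)
    have hv2 : (a.val : ℝ) < p := by exact_mod_cast ZMod.val_lt a
    have hv' : (0 : ℝ) < a.val := by exact_mod_cast hv
    rw [e, Complex.log_one_sub_exp]
    · push_cast; ring
    · have := hp.pos
      positivity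
    · rw [div_lt_iff₀ (by linarith)]
      nlinarith [Real.pi_pos]
  have h0 : ∑ a : ZMod p, (quadraticChar (ZMod p) a : ℂ) *
      (Real.log ‖1 - ZMod.stdAddChar a‖ : ℝ) = 0 := by
    rw [← self_eq_neg, ← sum_neg_distrib, ← Equiv.sum_comp (Equiv.neg (ZMod p))]
    refine sum_congr rfl fun a _ ↦ ?_
    rw [Equiv.neg_apply, MulChar.isOdd_quadraticChar_zmod p hp4]
    have : ‖1 - ZMod.stdAddChar (-a)‖ = ‖1 - ZMod.stdAddChar a‖ := by
      rw [← RCLike.norm_conj]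
      simp [AddChar.map_neg_eq_conj]
    rw [this]
    push_cast
    ring
  have h1 : ∑ a : ZMod p, (quadraticChar (ZMod p) a : ℂ) = 0 := by
    exact_mod_cast quadraticChar_sum_zero (F := ZMod p) (by rw [ZMod.ringChar_zmod_n]; omega)
  have h2 (a : ZMod p) : (quadraticChar (ZMod p) a : ℂ) * Complex.log (1 - ZMod.stdAddChar a) =
      (quadraticChar (ZMod p) a : ℂ) * (Real.log ‖1 - ZMod.stdAddChar a‖ : ℝ) +
      (Complex.I * (Real.pi / p) * ((quadraticChar (ZMod p) a : ℂ) * a.val) -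
        (quadraticChar (ZMod p) a : ℂ) * (Real.pi / 2 * Complex.I)) := by
    by_cases ha : a = 0
    · simp [ha]
    · rw [hlog a ha]; ring
  rw [sum_congr rfl fun a _ ↦ h2 a, sum_add_distrib, sum_sub_distrib, h0, ← mul_sum, ← sum_mul, h1]
  push_cast
  ring

/-- Inserting the additive expansion of χ(n) turns the series into a finite sum of -log(1 - xζ^a),
continuous up to x = 1 because 1 - ζ^a has positive real part for a ≠ 0. -/
theorem tendsto_powerSeries_quadraticChar (hp4 : p % 4 = 3) :
    Tendsto (fun x : ℝ ↦ ∑' n : ℕ, (quadraticChar (ZMod p) (n : ZMod p) : ℂ) / n * (x : ℂ) ^ n)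
      (𝓝[<] 1) (𝓝 ((-(Real.pi / (p * Real.sqrt p)) *
        ((∑ a : ZMod p, quadraticChar (ZMod p) a * (a.val : ℤ) : ℤ) : ℝ) : ℝ) : ℂ)) := by
  have hp : p.Prime := Fact.out
  have hp0 : (p : ℂ) ≠ 0 := by exact_mod_cast hp.ne_zero
  have hs0 : ((Real.sqrt p : ℝ) : ℂ) ≠ 0 := by
    rw [Complex.ofReal_ne_zero, Real.sqrt_ne_zero (Nat.cast_nonneg p)]
    exact_mod_cast hp.ne_zero
  set τ : ℂ := Complex.I * (Real.sqrt p : ℝ) with hτ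
  have hτ0 : τ ≠ 0 := mul_ne_zero Complex.I_ne_zero hs0
  have hnorm (a : ZMod p) : ‖ZMod.stdAddChar a‖ = 1 := by
    rw [ZMod.stdAddChar_apply]; exact Circle.norm_coe _
  have hsum (x : ℝ) (hx : x ∈ Set.Ioo (0 : ℝ) 1) :
      ∑' n : ℕ, (quadraticChar (ZMod p) (n : ZMod p) : ℂ) / n * (x : ℂ) ^ n =
      τ⁻¹ * -∑ a : ZMod p, (quadraticChar (ZMod p) a : ℂ) *
        Complex.log (1 - x * ZMod.stdAddChar a) := by
    have h1 : HasSum (fun n : ℕ ↦ ∑ a : ZMod p, (quadraticChar (ZMod p) a : ℂ) *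
        ((x * ZMod.stdAddChar a) ^ n / n)) (∑ a : ZMod p, (quadraticChar (ZMod p) a : ℂ) *
        -Complex.log (1 - x * ZMod.stdAddChar a)) := by
      refine hasSum_sum fun a _ ↦ (Complex.hasSum_taylorSeries_neg_log ?_).mul_left _
      rw [norm_mul, hnorm, mul_one, Complex.norm_real, Real.norm_of_nonneg hx.1.le]
      exact hx.2
    have h2 := h1.mul_left τ⁻¹
    simp only [mul_neg, sum_neg_distrib] at h2 ⊢
    rw [← h2.tsum_eq]
    refine tsum_congr fun n ↦ ?_
    have h3 := I_mul_sqrt_mul_quadraticChar p hp4 n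
    rw [← hτ] at h3
    rw [eq_inv_mul_iff_mul_eq₀ hτ0, div_mul_eq_mul_div, mul_div_assoc', ← mul_assoc, h3, sum_mul,
      sum_div]
    refine sum_congr rfl fun a _ ↦ ?_
    ring
  have hlim : Tendsto (fun x : ℝ ↦ τ⁻¹ * -∑ a : ZMod p, (quadraticChar (ZMod p) a : ℂ) *
      Complex.log (1 - x * ZMod.stdAddChar a)) (𝓝[<] 1)
      (𝓝 (τ⁻¹ * -∑ a : ZMod p, (quadraticChar (ZMod p) a : ℂ) *
        Complex.log (1 - ZMod.stdAddChar a))) := by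
    refine Tendsto.const_mul _ (Tendsto.neg (tendsto_finsetSum _ fun a _ ↦ ?_))
    by_cases ha : a = 0
    · simp [ha]
    refine Tendsto.const_mul _ (Tendsto.mono_left ?_ nhdsWithin_le_nhds)
    have hc : ContinuousAt (fun x : ℝ ↦ 1 - (x : ℂ) * ZMod.stdAddChar a) 1 := by fun_prop
    have hne : ZMod.stdAddChar a ≠ 1 := by
      rw [← (ZMod.stdAddChar (N := p)).map_zero_eq_one]
      exact fun h ↦ ha (ZMod.injective_stdAddChar h)
    have hslit : 1 - ((1 : ℝ) : ℂ) * ZMod.stdAddChar a ∈ Complex.slitPlane := by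
      rw [Complex.ofReal_one, one_mul, Complex.mem_slitPlane_iff]
      left
      rw [Complex.sub_re, Complex.one_re, sub_pos]
      refine lt_of_le_of_ne ((Complex.re_le_norm _).trans (hnorm a).le) fun h ↦ hne ?_
      have h2 := Complex.sq_norm_sub_sq_re (ZMod.stdAddChar a)
      rw [hnorm, h] at h2
      refine Complex.ext h ?_
      rw [Complex.one_im]
      nlinarith
    have := (hc.clog hslit).tendsto
    simpa using this
  rw [sum_quadraticChar_mul_log p hp4] at hlim
  have hval : ((-(Real.pi / (p * Real.sqrt p)) *
        ((∑ a : ZMod p, quadraticChar (ZMod p) a * (a.val : ℤ) : ℤ) : ℝ) : ℝ) : ℂ) =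
      τ⁻¹ * -(Complex.I * (Real.pi / p) *
        ((∑ a : ZMod p, quadraticChar (ZMod p) a * (a.val : ℤ) : ℤ) : ℂ)) := by
    rw [eq_inv_mul_iff_mul_eq₀ hτ0, hτ, Complex.ofReal_mul, Complex.ofReal_intCast]
    push_cast
    field_simp
  rw [hval]
  refine hlim.congr' ?_
  filter_upwards [Ioo_mem_nhdsLT (zero_lt_one (α := ℝ))] with x hx
  exact (hsum x hx).symm

theorem tendsto_LSeries_quadraticChar (hp4 : p % 4 = 3) :
    Tendsto (fun s : ℝ ↦ LSeries (fun n ↦ (quadraticChar (ZMod p) (n : ZMod p) : ℂ)) s)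
      (𝓝[>] 1) (𝓝 ((-(Real.pi / (p * Real.sqrt p)) *
        ((∑ a : ZMod p, quadraticChar (ZMod p) a * (a.val : ℤ) : ℤ) : ℝ) : ℝ) : ℂ)) :=
  tendsto_LSeries_of_tendsto_powerSeries (norm_sum_quadraticChar_le p (by omega))
    (fun _ hs ↦ LSeriesSummable_quadraticChar p hs) (tendsto_powerSeries_quadraticChar p hp4)

end LOne

end

/-! ### Integers, units and discriminant of ℚ(√-p) -/

section

open Finset NumberField

namespace QSqrtNeg

variable (p : ℕ)

/-- The generator `√-p` of `ℚ(√-p)`, as a complex number. -/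
noncomputable def sqrtNeg : ℂ := Complex.I * ((Real.sqrt (p : ℝ) : ℝ) : ℂ)

theorem sqrtNeg_sq : sqrtNeg p ^ 2 = -(p : ℂ) := by
  rw [sqrtNeg, mul_pow, Complex.I_sq, ← Complex.ofReal_pow, Real.sq_sqrt (Nat.cast_nonneg p)]
  simp

theorem sqrtNeg_mem : sqrtNeg p ∈ QSqrtNeg p := IntermediateField.mem_adjoin_simple_self ℚ _

theorem conj_sqrtNeg : (starRingEnd ℂ) (sqrtNeg p) = -sqrtNeg p := by
  simp [sqrtNeg]

variable {p} in
theorem eq_zero_of_add_mul_sqrtNeg_eq_zero (hp : 0 < p) {u v : ℝ}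
    (h : (u : ℂ) + v * sqrtNeg p = 0) : u = 0 ∧ v = 0 := by
  have h1 := congrArg Complex.re h
  have h2 := congrArg Complex.im h
  simp [sqrtNeg] at h1 h2
  exact ⟨h1, h2.resolve_right (by omega)⟩

theorem exists_rat_eq {x : ℂ} (hx : x ∈ QSqrtNeg p) : ∃ u v : ℚ, x = u + v * sqrtNeg p := by
  have hsq := sqrtNeg_sq p
  induction hx using IntermediateField.adjoin_induction with
  | mem x hx => exact ⟨0, 1, by rw [Set.mem_singleton_iff.1 hx, sqrtNeg]; simp⟩
  | algebraMap x => exact ⟨x, 0, by simp⟩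
  | add x y _ _ hx hy =>
    obtain ⟨u, v, rfl⟩ := hx
    obtain ⟨u', v', rfl⟩ := hy
    exact ⟨u + u', v + v', by push_cast; ring⟩
  | mul x y _ _ hx hy =>
    obtain ⟨u, v, rfl⟩ := hx
    obtain ⟨u', v', rfl⟩ := hy
    refine ⟨u * u' - p * v * v', u * v' + v * u', ?_⟩
    push_cast
    linear_combination (v : ℂ) * v' * hsq
  | inv x _ hx =>
    obtain ⟨u, v, rfl⟩ := hx
    refine ⟨u / (u ^ 2 + p * v ^ 2), -v / (u ^ 2 + p * v ^ 2), ?_⟩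
    -- If the norm vanishes the element is 0, and the witnesses still work since division by zero is
    -- 0.
    by_cases hn : u ^ 2 + p * v ^ 2 = 0
    · have hz : ((u : ℂ) + v * sqrtNeg p) * (u - v * sqrtNeg p) = 0 := by
        have : ((u : ℂ) ^ 2 + p * v ^ 2) = 0 := by exact_mod_cast hn
        linear_combination this - (v : ℂ) ^ 2 * hsq
      have hu : u = 0 := by
        have : 0 ≤ (p : ℚ) * v ^ 2 := by positivity
        nlinarith [sq_nonneg u]
      have : (v * sqrtNeg p : ℂ) = 0 := by
        rw [hu] at hz
        simpa using hz
      rw [this, hn, hu]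
      simp
    · have hn' : ((u : ℂ) ^ 2 + p * v ^ 2) ≠ 0 := by exact_mod_cast hn
      have : ((u : ℂ) + v * sqrtNeg p) * (u - v * sqrtNeg p) = (u : ℂ) ^ 2 + p * v ^ 2 := by
        linear_combination - (v : ℂ) ^ 2 * hsq
      refine inv_eq_of_mul_eq_one_right ?_
      push_cast
      rw [← div_self hn', ← this]
      ring

theorem exists_int_of_isIntegral_rat {q : ℚ} (h : IsIntegral ℤ (q : ℂ)) : ∃ n : ℤ, (n : ℚ) = q := by
  have h1 : IsIntegral ℤ q :=
    (isIntegral_algHom_iff ((algebraMap ℚ ℂ).toIntAlgHom) (algebraMap ℚ ℂ).injective).1 h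
  obtain ⟨n, hn⟩ := IsIntegrallyClosed.isIntegral_iff.1 h1
  exact ⟨n, hn⟩

variable {p}

/-- The trace s = 2u and the norm n = u^2 + p v^2 are integers. From p (2v)^2 = 4n - s^2 and
primality of p, w = 2v is an integer too; then s^2 + p w^2 = 4n with p ≡ 3 mod 4 forces s and w to
have the same parity. -/
theorem exists_int_eq [Fact p.Prime] (hp4 : p % 4 = 3) {x : ℂ} (hx : x ∈ QSqrtNeg p)
    (hi : IsIntegral ℤ x) : ∃ a b : ℤ, x = a + b * ((1 + sqrtNeg p) / 2) := by
  have hp : p.Prime := Fact.out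
  obtain ⟨u, v, rfl⟩ := exists_rat_eq p hx
  have hsq := sqrtNeg_sq p
  have hconj : (starRingEnd ℂ) (u + v * sqrtNeg p) = u - v * sqrtNeg p := by
    simp [conj_sqrtNeg]; ring
  have hi' : IsIntegral ℤ ((u : ℂ) - v * sqrtNeg p) := by
    rw [← hconj]
    exact hi.map ((starRingEnd ℂ).toIntAlgHom)
  obtain ⟨s, hs⟩ : ∃ s : ℤ, (s : ℚ) = 2 * u := by
    refine exists_int_of_isIntegral_rat ?_
    have h := hi.add hi'
    rwa [show (u + v * sqrtNeg p + (u - v * sqrtNeg p) : ℂ) = ((2 * u : ℚ) : ℂ) by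
      push_cast; ring] at h
  obtain ⟨n, hn⟩ : ∃ n : ℤ, (n : ℚ) = u ^ 2 + p * v ^ 2 := by
    refine exists_int_of_isIntegral_rat ?_
    have h := hi.mul hi'
    rwa [show ((u + v * sqrtNeg p) * (u - v * sqrtNeg p) : ℂ) = ((u ^ 2 + p * v ^ 2 : ℚ) : ℂ) by
      push_cast; linear_combination -(v : ℂ) ^ 2 * hsq] at h
  have h1 : (p : ℚ) * (2 * v) ^ 2 = ((4 * n - s ^ 2 : ℤ) : ℚ) := by
    push_cast
    rw [hs, hn]
    ring
  obtain ⟨t, ht⟩ : ∃ t : ℤ, (t : ℚ) = p * (2 * v) := by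
    have : IsIntegral ℤ ((p : ℚ) * (2 * v)) := by
      refine IsIntegral.of_pow two_pos ?_
      have e : ((p : ℚ) * (2 * v)) ^ 2 = ((p * (4 * n - s ^ 2) : ℤ) : ℚ) := by
        push_cast at h1 ⊢
        linear_combination (p : ℚ) * h1
      rw [e]
      exact isIntegral_algebraMap (R := ℤ) (A := ℚ)
    exact IsIntegrallyClosed.isIntegral_iff.1 this
  have hpt : (p : ℤ) ∣ t := by
    refine Int.Prime.dvd_pow' (k := 2) hp ⟨4 * n - s ^ 2, ?_⟩
    have : (t : ℚ) ^ 2 = ((p * (4 * n - s ^ 2) : ℤ) : ℚ) := by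
      rw [ht]
      push_cast at h1 ⊢
      linear_combination (p : ℚ) * h1
    exact_mod_cast this
  obtain ⟨w, rfl⟩ := hpt
  have hp0 : (p : ℚ) ≠ 0 := by exact_mod_cast hp.ne_zero
  have hw : (w : ℚ) = 2 * v := by
    push_cast at ht
    exact mul_left_cancel₀ hp0 ht
  rw [← hw] at h1
  have h2 : (p : ℤ) * w ^ 2 = 4 * n - s ^ 2 := by exact_mod_cast h1
  have hpar : (2 : ℤ) ∣ s - w := by
    obtain ⟨q, hq⟩ : ∃ q : ℤ, (p : ℤ) = 4 * q + 3 := ⟨(p / 4 : ℕ), by omega⟩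
    rw [hq] at h2
    have h3 : Even (s ^ 2 - w ^ 2) := ⟨2 * n - 2 * q * w ^ 2 - 2 * w ^ 2, by linarith⟩
    rw [Int.even_sub, Int.even_pow' two_ne_zero, Int.even_pow' two_ne_zero, ← Int.even_sub] at h3
    exact h3.two_dvd
  obtain ⟨a, ha⟩ := hpar
  refine ⟨a, w, ?_⟩
  have hs' : (s : ℂ) = 2 * u := by exact_mod_cast congrArg (fun q : ℚ ↦ (q : ℂ)) hs
  have hw' : (w : ℂ) = 2 * v := by exact_mod_cast congrArg (fun q : ℚ ↦ (q : ℂ)) hw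
  have ha' : (s : ℂ) - w = 2 * a := by exact_mod_cast ha
  linear_combination (-1 / 2 : ℂ) * hs' + (-1 / 2 - 1 / 2 * (sqrtNeg p - 1) : ℂ) * hw' +
    (1 / 2 : ℂ) * ha'

section Omega

/-- The norm `(p + 1) / 4` of `(1 + √-p) / 2`. -/
def normOmega (p : ℕ) : ℕ := (p + 1) / 4

theorem four_mul_normOmega (hp4 : p % 4 = 3) : 4 * normOmega p = p + 1 := by
  rw [normOmega]; omega

/-- `(1 + √-p) / 2`, as an element of `ℚ(√-p)`. -/
noncomputable def omegaK (p : ℕ) : QSqrtNeg p :=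
  ⟨(1 + sqrtNeg p) / 2, div_mem (add_mem (one_mem _) (sqrtNeg_mem p))
    (by exact_mod_cast natCast_mem (QSqrtNeg p) 2)⟩

theorem omegaK_sq (hp4 : p % 4 = 3) :
    omegaK p ^ 2 = omegaK p - (normOmega p : QSqrtNeg p) := by
  have h : 4 * (normOmega p : ℂ) = p + 1 := by exact_mod_cast four_mul_normOmega hp4
  apply Subtype.ext
  simp only [omegaK, SubmonoidClass.mk_pow, AddSubgroupClass.coe_sub, SubringClass.coe_natCast]
  linear_combination (1 / 4 : ℂ) * sqrtNeg_sq p + (1 / 4 : ℂ) * h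

theorem isIntegral_omegaK (hp4 : p % 4 = 3) : IsIntegral ℤ (omegaK p) := by
  refine ⟨Polynomial.X ^ 2 - Polynomial.X + Polynomial.C (normOmega p : ℤ), ?_, ?_⟩
  · monicity!
  · simp [omegaK_sq hp4]

/-- `(1 + √-p) / 2`, as an algebraic integer. -/
noncomputable def omega (hp4 : p % 4 = 3) : 𝓞 (QSqrtNeg p) := ⟨omegaK p, isIntegral_omegaK hp4⟩

variable (hp4 : p % 4 = 3)

/-- The inclusion of the ring of integers of `ℚ(√-p)` into `ℂ`. -/
noncomputable def toComplex (p : ℕ) : 𝓞 (QSqrtNeg p) →+* ℂ :=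
  (QSqrtNeg p).val.toRingHom.comp (algebraMap (𝓞 (QSqrtNeg p)) (QSqrtNeg p))

theorem toComplex_injective : Function.Injective (toComplex p) :=
  (QSqrtNeg p).val.injective.comp RingOfIntegers.coe_injective

theorem toComplex_omega : toComplex p (omega hp4) = (1 + sqrtNeg p) / 2 := rfl

theorem omega_sq : omega hp4 ^ 2 = omega hp4 - (normOmega p : 𝓞 (QSqrtNeg p)) := by
  apply RingOfIntegers.coe_injective
  rw [map_pow, map_sub, map_natCast]
  exact omegaK_sq hp4

theorem eq_zero_of_add_mul_omega_eq_zero {a b : ℤ}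
    (h : (a : 𝓞 (QSqrtNeg p)) + b * omega hp4 = 0) : a = 0 ∧ b = 0 := by
  have h1 := congrArg (toComplex p) h
  rw [map_add, map_mul, map_intCast, map_intCast, toComplex_omega, map_zero] at h1
  obtain ⟨h2, h3⟩ := eq_zero_of_add_mul_sqrtNeg_eq_zero (p := p) (by omega) (u := a + b / 2)
    (v := b / 2) (by push_cast; linear_combination h1)
  have hb : (b : ℝ) = 0 := by linarith
  have ha : (a : ℝ) = 0 := by rw [hb] at h2; linarith
  exact ⟨by exact_mod_cast ha, by exact_mod_cast hb⟩

variable [Fact p.Prime]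

theorem exists_eq_add_mul_omega (x : 𝓞 (QSqrtNeg p)) :
    ∃ a b : ℤ, x = a + b * omega hp4 := by
  have hi : IsIntegral ℤ (toComplex p x) :=
    (RingOfIntegers.isIntegral x).map (toComplex p).toIntAlgHom
  obtain ⟨a, b, h⟩ := exists_int_eq hp4 (x := toComplex p x) (x : QSqrtNeg p).2 hi
  refine ⟨a, b, toComplex_injective ?_⟩
  rw [h, map_add, map_mul, map_intCast, map_intCast, toComplex_omega]

/-- The integral basis `1, (1 + √-p) / 2` of `ℚ(√-p)`. -/
noncomputable def intBasis : Module.Basis (Fin 2) ℤ (𝓞 (QSqrtNeg p)) :=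
  Module.Basis.mk (v := ![1, omega hp4])
    (LinearIndependent.pair_iff.2 fun a b h ↦
      eq_zero_of_add_mul_omega_eq_zero hp4 (by simpa [zsmul_eq_mul] using h))
    (fun x _ ↦ by
      obtain ⟨a, b, rfl⟩ := exists_eq_add_mul_omega hp4 x
      rw [Matrix.range_cons_cons_empty, Submodule.mem_span_pair]
      exact ⟨a, b, by simp [zsmul_eq_mul]⟩)

theorem intBasis_zero : intBasis hp4 0 = 1 := by simp [intBasis]

theorem intBasis_one : intBasis hp4 1 = omega hp4 := by simp [intBasis]

theorem nrRealPlaces_eq : InfinitePlace.nrRealPlaces (QSqrtNeg p) = 0 := by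
  refine (@Fintype.card_eq_zero_iff _ (_)).2 ⟨fun ⟨w, hw⟩ ↦ ?_⟩
  have hφ := InfinitePlace.isReal_iff.1 hw
  set δ : QSqrtNeg p := ⟨sqrtNeg p, sqrtNeg_mem p⟩
  have h1 : δ ^ 2 = -(p : QSqrtNeg p) := Subtype.ext (by simpa using sqrtNeg_sq p)
  have h2 := congrArg (hφ.embedding) h1
  rw [map_pow, map_neg, map_natCast] at h2
  have h3 := sq_nonneg (hφ.embedding δ)
  have h4 : (0 : ℝ) < p := by exact_mod_cast (Fact.out : p.Prime).pos
  linarith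

include hp4

theorem finrank_int : Module.finrank ℤ (𝓞 (QSqrtNeg p)) = 2 := by
  rw [Module.finrank_eq_card_basis (intBasis hp4), Fintype.card_fin]

theorem finrank_rat : Module.finrank ℚ (QSqrtNeg p) = 2 := by
  rw [← RingOfIntegers.rank, finrank_int hp4]

theorem trace_omega : Algebra.trace ℤ (𝓞 (QSqrtNeg p)) (omega hp4) = 1 := by
  have e0 : omega hp4 * intBasis hp4 0 = intBasis hp4 1 := by
    rw [intBasis_zero, intBasis_one, mul_one]
  have e1 : omega hp4 * intBasis hp4 1 =
      intBasis hp4 1 - (normOmega p : ℤ) • intBasis hp4 0 := by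
    rw [intBasis_zero, intBasis_one, ← sq, omega_sq]
    simp [zsmul_eq_mul]
  rw [Algebra.trace_eq_matrix_trace (intBasis hp4), Matrix.trace_fin_two,
    Algebra.leftMulMatrix_eq_repr_mul, Algebra.leftMulMatrix_eq_repr_mul, e0, e1,
    map_sub, map_smul]
  simp

theorem discr_eq : discr (QSqrtNeg p) = -p := by
  have h1 : Algebra.trace ℤ (𝓞 (QSqrtNeg p)) 1 = 2 := by
    have := Algebra.trace_algebraMap (R := ℤ) (S := 𝓞 (QSqrtNeg p)) 1
    rw [map_one, finrank_int hp4] at this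
    simpa using this
  have h2 : Algebra.trace ℤ (𝓞 (QSqrtNeg p)) (omega hp4 * omega hp4) =
      1 - 2 * (normOmega p) := by
    have e : omega hp4 * omega hp4 = omega hp4 - (normOmega p : ℤ) • 1 := by
      rw [← sq, omega_sq]; simp [zsmul_eq_mul]
    rw [e, map_sub, map_smul, trace_omega, h1]
    simp; ring
  rw [← discr_eq_discr _ (intBasis hp4), Algebra.discr_def, Matrix.det_fin_two]
  simp only [Algebra.traceMatrix_apply, Algebra.traceForm_apply, intBasis_zero, intBasis_one,
    one_mul, mul_one, h1, h2, trace_omega]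
  have := four_mul_normOmega hp4
  zify at this
  linarith


theorem nrComplexPlaces_eq : InfinitePlace.nrComplexPlaces (QSqrtNeg p) = 1 := by
  have := InfinitePlace.card_add_two_mul_card_eq_rank (QSqrtNeg p)
  rw [nrRealPlaces_eq, finrank_rat hp4] at this
  omega

theorem regulator_eq : Units.regulator (QSqrtNeg p) = 1 := by
  have h : Units.rank (QSqrtNeg p) = 0 := by
    rw [Units.rank, InfinitePlace.card_eq_nrRealPlaces_add_nrComplexPlaces, nrRealPlaces_eq,
      nrComplexPlaces_eq hp4]
  have h1 : IsEmpty (Fin (Units.rank (QSqrtNeg p))) := by rw [h]; infer_instance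
  have h2 := (Units.equivFinRank (QSqrtNeg p)).symm.isEmpty
  classical
  rw [Units.regulator_eq_det', Matrix.det_isEmpty, abs_one]

/-- A root of unity a + bω has absolute value 1, that is (2a+b)^2 + p b^2 = 4. With p ≥ 7 this
leaves only b = 0, a = ±1. -/
theorem torsionOrder_eq (hp3 : 3 < p) : Units.torsionOrder (QSqrtNeg p) = 2 := by
  have h (u : Units.torsion (QSqrtNeg p)) : (u : (𝓞 (QSqrtNeg p))ˣ) = 1 ∨
      (u : (𝓞 (QSqrtNeg p))ˣ) = -1 := by
    obtain ⟨a, b, hab⟩ := exists_eq_add_mul_omega hp4 ((u : (𝓞 (QSqrtNeg p))ˣ) : 𝓞 (QSqrtNeg p))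
    have hn : ‖toComplex p ((u : (𝓞 (QSqrtNeg p))ˣ) : 𝓞 (QSqrtNeg p))‖ = 1 := by
      obtain ⟨n, hn0, hn⟩ := isOfFinOrder_iff_pow_eq_one.1 ((CommGroup.mem_torsion _).1 u.2)
      refine Complex.norm_eq_one_of_pow_eq_one (n := n) ?_ hn0.ne'
      rw [← map_pow, ← Units.val_pow_eq_pow_val, hn, Units.val_one, map_one]
    have hsq : Complex.normSq (toComplex p ((u : (𝓞 (QSqrtNeg p))ˣ) : 𝓞 (QSqrtNeg p))) = 1 := by
      rw [Complex.normSq_eq_norm_sq, hn, one_pow]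
    rw [hab, map_add, map_mul, map_intCast, map_intCast, toComplex_omega] at hsq
    have e : (a : ℂ) + b * ((1 + sqrtNeg p) / 2) =
        ((a + b / 2 : ℝ) : ℂ) + ((b / 2 * Real.sqrt p : ℝ) : ℂ) * Complex.I := by
      rw [sqrtNeg]; push_cast; ring
    rw [e, Complex.normSq_add_mul_I, mul_pow, Real.sq_sqrt (Nat.cast_nonneg p)] at hsq
    have h2 : (2 * a + b) ^ 2 + p * b ^ 2 = 4 := by
      have : ((2 * a + b) ^ 2 + p * b ^ 2 : ℝ) = 4 := by linear_combination 4 * hsq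
      exact_mod_cast this
    have hb : b = 0 := by
      by_contra hb
      have : 1 ≤ b ^ 2 := by
        have := Int.one_le_abs hb
        rw [← sq_abs]
        nlinarith
      have hp7 : (7 : ℤ) ≤ p := by omega
      nlinarith [sq_nonneg (2 * a + b)]
    subst hb
    have ha : (a - 1) * (a + 1) = 0 := by linarith
    rcases mul_eq_zero.1 ha with h | h
    · left
      ext
      rw [hab, show a = 1 by omega]
      simp
    · right
      ext
      rw [hab, show a = -1 by omega]
      simp
  refine Nat.card_eq_two_iff.2 ⟨1, ⟨-1, neg_one_mem_torsion⟩, ?_, ?_⟩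
  · intro h1
    have h2 := congrArg (fun u : Units.torsion (QSqrtNeg p) ↦
      ((u : (𝓞 (QSqrtNeg p))ˣ) : 𝓞 (QSqrtNeg p))) h1
    have h3 : (1 : 𝓞 (QSqrtNeg p)) = -1 := by simpa using h2
    exact one_ne_zero (self_eq_neg.1 h3)
  · refine Set.eq_univ_of_forall fun u ↦ ?_
    rcases h u with h | h
    · exact Or.inl (Subtype.ext h)
    · exact Or.inr (Subtype.ext h)

theorem dedekindZeta_residue_eq (hp3 : 3 < p) :
    dedekindZeta_residue (QSqrtNeg p) = Real.pi * h2minus p / Real.sqrt p := by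
  rw [dedekindZeta_residue_def, nrRealPlaces_eq, nrComplexPlaces_eq hp4, regulator_eq hp4,
    torsionOrder_eq hp4 hp3, discr_eq hp4, h2minus]
  simp
  ring

end Omega

end QSqrtNeg

end

/-! ### Counting ideals of given norm -/

section

open Finset NumberField

namespace Ideal

theorem one_mem_of_isCoprime {S : Type*} [CommRing S] {I : Ideal S} {a b : ℤ} (hab : IsCoprime a b) (ha : (a : S) ∈ I)
    (hb : (b : S) ∈ I) : (1 : S) ∈ I := by
  obtain ⟨u, v, h⟩ := hab
  have : (1 : S) = u * a + v * b := by rw [← Int.cast_mul, ← Int.cast_mul, ← Int.cast_add, h, Int.cast_one]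
  rw [this]
  exact add_mem (I.mul_mem_left _ ha) (I.mul_mem_left _ hb)

section Counting

variable {S : Type*} [CommRing S] [IsDedekindDomain S] [Module.Free ℤ S]

theorem eq_of_le_of_absNorm_eq {I J : Ideal S} (h : I ≤ J) (hn : absNorm I = absNorm J)
    (h0 : absNorm I ≠ 0) : I = J := by
  obtain ⟨L, rfl⟩ := dvd_iff_le.2 h
  rw [map_mul] at hn h0
  have : absNorm L = 1 := Nat.eq_of_mul_eq_mul_left
    (Nat.pos_of_ne_zero (left_ne_zero_of_mul h0)) (by rw [hn, mul_one])
  rw [absNorm_eq_one_iff.1 this, mul_top]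

/-- The ideal J contains n, which is prime to m, so J + (m) is the whole ring and I = I(J + (m)).
Thus I is recovered from the product IJ, which gives injectivity in `normCount_mul`. -/
theorem mul_sup_span_natCast {I J : Ideal S} {m n : ℕ} (hmn : m.Coprime n) (hI : absNorm I = m)
    (hJ : absNorm J = n) : I * J ⊔ span {(m : S)} = I := by
  have hm : (m : S) ∈ I := hI ▸ absNorm_mem I
  have hn : (n : S) ∈ J := hJ ▸ absNorm_mem J
  refine le_antisymm (sup_le mul_le_left ((span_singleton_le_iff_mem _).2 hm)) ?_
  have htop : J ⊔ span {(m : S)} = ⊤ := by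
    rw [eq_top_iff_one]
    refine one_mem_of_isCoprime (a := m) (b := n) (Nat.isCoprime_iff_coprime.2 hmn) ?_ ?_
    · exact mem_sup_right (by simp)
    · exact mem_sup_left (by simpa using hn)
  calc I = I * (J ⊔ span {(m : S)}) := by rw [htop, mul_top]
    _ = I * J ⊔ I * span {(m : S)} := mul_sup _ _ _
    _ ≤ I * J ⊔ span {(m : S)} := sup_le_sup_left mul_le_right _

variable (S) in
/-- The number of ideals of norm `n`. -/
noncomputable def normCount (n : ℕ) : ℕ := Nat.card {I : Ideal S // absNorm I = n}

theorem normCount_one : normCount S 1 = 1 := by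
  refine Nat.card_eq_one_iff_unique.2 ⟨⟨fun I J ↦ Subtype.ext ?_⟩, ⟨⟨⊤, absNorm_top⟩⟩⟩
  rw [absNorm_eq_one_iff.1 I.2, absNorm_eq_one_iff.1 J.2]

theorem sup_mul_sup_span_natCast {A : Ideal S} {m n : ℕ} (hmn : m.Coprime n)
    (hA : absNorm A = m * n) : (A ⊔ span {(m : S)}) * (A ⊔ span {(n : S)}) = A := by
  have hmnA : ((m * n : ℕ) : S) ∈ A := hA ▸ absNorm_mem A
  refine le_antisymm ?_ ?_
  · rw [sup_mul, mul_sup, mul_sup, span_singleton_mul_span_singleton]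
    refine sup_le (sup_le mul_le_left mul_le_left) (sup_le mul_le_right ?_)
    rw [span_singleton_le_iff_mem]
    exact_mod_cast hmnA
  · have htop : span {(m : S)} ⊔ span {(n : S)} = ⊤ := by
      rw [eq_top_iff_one]
      refine one_mem_of_isCoprime (a := m) (b := n) (Nat.isCoprime_iff_coprime.2 hmn) ?_ ?_
      · exact mem_sup_left (by simp)
      · exact mem_sup_right (by simp)
    calc A = A * (span {(m : S)} ⊔ span {(n : S)}) := by rw [htop, mul_top]
      _ = A * span {(m : S)} ⊔ A * span {(n : S)} := mul_sup _ _ _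
      _ ≤ _ := by
        refine sup_le ?_ ?_
        · rw [mul_comm]
          exact mul_mono le_sup_right le_sup_left
        · exact mul_mono le_sup_left le_sup_right

variable [Module.Finite ℤ S]

/-- The norm of A + (m) divides a power of m, hence is prime to n; as it divides mn, it divides m.
The same holds for n, and the product of the two norms is mn. -/
theorem absNorm_sup_span_natCast {A : Ideal S} {m n : ℕ} (hmn : m.Coprime n) (hm0 : m ≠ 0)
    (hA : absNorm A = m * n) :
    absNorm (A ⊔ span {(m : S)}) = m ∧ absNorm (A ⊔ span {(n : S)}) = n := by
  have hprod := congrArg absNorm (sup_mul_sup_span_natCast hmn hA)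
  rw [map_mul, hA] at hprod
  have hd (k : ℕ) : absNorm (A ⊔ span {(k : S)}) ∣ k ^ Module.finrank ℤ S := by
    rw [← absNorm_span_natCast]
    exact absNorm_dvd_absNorm_of_le le_sup_right
  have h1 : absNorm (A ⊔ span {(m : S)}) ∣ m :=
    Nat.Coprime.dvd_of_dvd_mul_right
      (Nat.Coprime.coprime_dvd_left (hd m) (hmn.pow_left _)) (hprod ▸ dvd_mul_right _ _)
  have h2 : absNorm (A ⊔ span {(n : S)}) ∣ n :=
    Nat.Coprime.dvd_of_dvd_mul_left
      (Nat.Coprime.coprime_dvd_left (hd n) (hmn.symm.pow_left _)) (hprod ▸ dvd_mul_left _ _)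
  obtain ⟨c, hc⟩ := h1
  obtain ⟨e, he⟩ := h2
  -- For n = 0 coprimality forces m = 1 and A is the zero ideal, where cancellation is unavailable.
  by_cases hn0 : n = 0
  · subst hn0
    have hm1 : m = 1 := by simpa using hmn
    subst hm1
    rw [mul_zero] at hA
    simp [absNorm_eq_zero_iff.1 hA]
  · have hx := Nat.pos_of_ne_zero (left_ne_zero_of_mul (hc ▸ hm0))
    have hy := Nat.pos_of_ne_zero (left_ne_zero_of_mul (he ▸ hn0))
    set x := absNorm (A ⊔ span {(m : S)})
    set y := absNorm (A ⊔ span {(n : S)})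
    have hce : x * y * (c * e) = x * y * 1 := by
      calc x * y * (c * e) = (x * c) * (y * e) := by ring
        _ = x * y * 1 := by rw [← hc, ← he, mul_one, hprod]
    have := Nat.eq_of_mul_eq_mul_left (Nat.mul_pos hx hy) hce
    rw [hc, he, Nat.eq_one_of_mul_eq_one_right this, Nat.eq_one_of_mul_eq_one_left this]
    simp

theorem normCount_mul {m n : ℕ} (hmn : m.Coprime n) (hm0 : m ≠ 0) :
    normCount S (m * n) = normCount S m * normCount S n := by
  rw [normCount, normCount, normCount, ← Nat.card_prod]
  refine (Nat.card_eq_of_bijective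
    (fun q : {I : Ideal S // absNorm I = m} × {I : Ideal S // absNorm I = n} ↦
      (⟨q.1.1 * q.2.1, by rw [map_mul, q.1.2, q.2.2]⟩ : {I : Ideal S // absNorm I = m * n}))
    ⟨?_, ?_⟩).symm
  · rintro ⟨⟨I, hI⟩, ⟨J, hJ⟩⟩ ⟨⟨I', hI'⟩, ⟨J', hJ'⟩⟩ h
    have h' : I * J = I' * J' := congrArg Subtype.val h
    have e1 := mul_sup_span_natCast hmn hI hJ
    rw [h', mul_sup_span_natCast hmn hI' hJ'] at e1
    have e2 := mul_sup_span_natCast hmn.symm hJ hI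
    rw [mul_comm, h', mul_comm, mul_sup_span_natCast hmn.symm hJ' hI'] at e2
    subst e1 e2
    rfl
  · rintro ⟨A, hA⟩
    obtain ⟨h1, h2⟩ := absNorm_sup_span_natCast hmn hm0 hA
    exact ⟨(⟨_, h1⟩, ⟨_, h2⟩), Subtype.ext (sup_mul_sup_span_natCast hmn hA)⟩

variable {q f : ℕ} {P₁ P₂ : Ideal S}

/-- Induction on k, splitting off one prime above q at a time. P₁ = P₂ is allowed, so that a single
prime above q is covered as well. -/
theorem exists_eq_pow_mul_pow (hq : q.Prime)
    (h1 : absNorm P₁ = q ^ f) (h2 : absNorm P₂ = q ^ f)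
    (hP : ∀ P : Ideal S, P.IsMaximal → (q : S) ∈ P → P = P₁ ∨ P = P₂) (k : ℕ) (I : Ideal S)
    (hI : absNorm I = q ^ k) : ∃ i j, I = P₁ ^ i * P₂ ^ j ∧ k = f * (i + j) := by
  induction k using Nat.strong_induction_on generalizing I with
  | _ k ih =>
  rcases Nat.eq_zero_or_pos k with rfl | hk
  · exact ⟨0, 0, by simpa using hI, rfl⟩
  · obtain ⟨P, hPm, hPu, J, rfl⟩ := exists_isMaximal_dvd_of_dvd_absNorm' hq I
      (hI ▸ dvd_pow_self q hk.ne')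
    have hqP : (q : S) ∈ P := by
      have : (q : ℤ) ∈ P.under ℤ := hPu ▸ mem_span_singleton_self _
      simpa [under_def] using this
    have hPn : absNorm P = q ^ f := by rcases hP P hPm hqP with rfl | rfl <;> assumption
    rw [map_mul, hPn] at hI
    obtain ⟨l, -, hl⟩ := (Nat.dvd_prime_pow hq).1 (hI ▸ dvd_mul_left (absNorm J) (q ^ f))
    rw [hl, ← pow_add] at hI
    have hfl := Nat.pow_right_injective hq.two_le hI
    have hf : 0 < f := by
      rcases Nat.eq_zero_or_pos f with rfl | hf
      · exact absurd (absNorm_eq_one_iff.1 (by simpa using hPn)) hPm.ne_top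
      · exact hf
    obtain ⟨i, j, rfl, rfl⟩ := ih l (by omega) J hl
    rcases hP P hPm hqP with rfl | rfl
    · exact ⟨i + 1, j, by ring, by rw [← hfl]; ring⟩
    · exact ⟨i, j + 1, by ring, by rw [← hfl]; ring⟩

theorem normCount_prime_pow_of_unique (hq : q.Prime) (hf : 0 < f) (h1 : absNorm P₁ = q ^ f)
    (hP : ∀ P : Ideal S, P.IsMaximal → (q : S) ∈ P → P = P₁) (k : ℕ) :
    normCount S (q ^ k) = if f ∣ k then 1 else 0 := by
  have key := exists_eq_pow_mul_pow hq h1 h1 (fun P hm hq ↦ Or.inl (hP P hm hq)) k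
  split_ifs with hfk
  · obtain ⟨i, rfl⟩ := hfk
    refine Nat.card_eq_one_iff_unique.2 ⟨⟨fun I J ↦ Subtype.ext ?_⟩,
      ⟨⟨P₁ ^ i, by rw [map_pow, h1, pow_mul]⟩⟩⟩
    obtain ⟨a, b, hI, hab⟩ := key I.1 I.2
    obtain ⟨a', b', hJ, hab'⟩ := key J.1 J.2
    rw [hI, hJ, ← pow_add, ← pow_add, ← Nat.eq_of_mul_eq_mul_left hf hab,
      ← Nat.eq_of_mul_eq_mul_left hf hab']
  · have : IsEmpty {I : Ideal S // absNorm I = q ^ k} := by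
      refine ⟨fun I ↦ hfk ?_⟩
      obtain ⟨i, j, -, h⟩ := key I.1 I.2
      exact ⟨_, h⟩
    rw [normCount, Nat.card_of_isEmpty]

theorem normCount_prime_pow_of_two (hq : q.Prime) (h1 : absNorm P₁ = q) (h2 : absNorm P₂ = q)
    (hne : P₁ ≠ P₂)
    (hP : ∀ P : Ideal S, P.IsMaximal → (q : S) ∈ P → P = P₁ ∨ P = P₂) (k : ℕ) :
    normCount S (q ^ k) = k + 1 := by
  have key := exists_eq_pow_mul_pow hq (f := 1) (by rw [h1, pow_one]) (by rw [h2, pow_one]) hP k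
  have hset : {I : Ideal S | absNorm I = q ^ k} =
      (fun i ↦ P₁ ^ i * P₂ ^ (k - i)) '' (range (k + 1) : Set ℕ) := by
    ext I
    simp only [Set.mem_ofPred_eq, Set.mem_image, coe_range, Set.mem_Iio]
    constructor
    · intro hI
      obtain ⟨i, j, hIe, h⟩ := key I hI
      refine ⟨i, by omega, ?_⟩
      rw [hIe, show k - i = j by omega]
    · rintro ⟨i, hi, rfl⟩
      rw [map_mul, map_pow, map_pow, h1, h2, ← pow_add, show i + (k - i) = k by omega]
  have hp1 : P₁.IsPrime := isPrime_of_irreducible_absNorm (h1 ▸ hq)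
  have hp2 : P₂.IsPrime := isPrime_of_irreducible_absNorm (h2 ▸ hq)
  have h10 : P₁ ≠ ⊥ := fun h ↦ hq.ne_zero (by rw [← h1, h, absNorm_bot])
  have hnot : ¬ P₂ ≤ P₁ := fun h ↦
    hne (eq_of_le_of_absNorm_eq h (h2.trans h1.symm) (h2 ▸ hq.ne_zero)).symm
  -- Cancelling P₁^i from an equality of two such products would put a power of P₂ inside P₁, hence
  -- P₂ itself, and equal norms would give P₁ = P₂.
  have hlt (i i' : ℕ) (hi' : i' ≤ k) (hii : i < i') :
      P₁ ^ i * P₂ ^ (k - i) ≠ P₁ ^ i' * P₂ ^ (k - i') := by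
    intro h
    rw [show i' = i + (i' - i) by omega, pow_add, mul_assoc] at h
    have h3 := mul_left_cancel₀ (pow_ne_zero i h10) h
    have h4 : P₂ ^ (k - i) ≤ P₁ := by
      rw [h3]
      exact mul_le_left.trans (pow_le_self (Nat.sub_ne_zero_of_lt hii))
    exact hnot (hp1.le_of_pow_le h4)
  have hinj : Set.InjOn (fun i ↦ P₁ ^ i * P₂ ^ (k - i)) (range (k + 1) : Set ℕ) := by
    intro i hi i' hi' h
    simp only [coe_range, Set.mem_Iio] at hi hi'
    rcases lt_trichotomy i i' with hl | hl | hl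
    · exact absurd h (hlt i i' (by omega) hl)
    · exact hl
    · exact absurd h.symm (hlt i' i (by omega) hl)
  change Set.ncard {I : Ideal S | absNorm I = q ^ k} = k + 1
  rw [hset, hinj.ncard_image, Set.ncard_coe_finset, card_range]

end Counting

end Ideal

end

/-! ### Splitting of rational primes in ℚ(√-p) -/

section

open Finset NumberField Filter Topology

theorem legendreSym_neg_eq_of_mod_four_eq_three (p q : ℕ) [Fact p.Prime] [Fact q.Prime]
    (hp4 : p % 4 = 3) (hq2 : q ≠ 2) :
    legendreSym q (-(p : ℤ)) = legendreSym p q := by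
  have hq : q.Prime := Fact.out
  have hodd : q % 2 = 1 := hq.eq_two_or_odd.resolve_left hq2
  rw [← neg_one_mul, legendreSym.mul, legendreSym.at_neg_one hq2]
  rcases (by omega : q % 4 = 1 ∨ q % 4 = 3) with h | h
  · rw [ZMod.χ₄_nat_one_mod_four h, one_mul]
    exact (legendreSym.quadratic_reciprocity_one_mod_four h (by omega)).symm
  · rw [ZMod.χ₄_nat_three_mod_four h,
      legendreSym.quadratic_reciprocity_three_mod_four hp4 h]
    ring

namespace QSqrtNeg

variable {p : ℕ}

theorem four_mul_sub_add_normOmega (hp4 : p % 4 = 3) (r : ℤ) :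
    4 * (r ^ 2 - r + normOmega p) = (2 * r - 1) ^ 2 + p := by
  have h : 4 * (normOmega p : ℤ) = p + 1 := by exact_mod_cast four_mul_normOmega hp4
  linear_combination h

section Roots

variable [Fact p.Prime] (hp4 : p % 4 = 3) {q : ℕ} (hq : q.Prime)

include hp4 hq

/-- For odd q, completing the square makes -p a square modulo q, and reciprocity transfers this to q
modulo p. For q = 2 a root means that (p+1)/4 is even, so p ≡ 7 mod 8 and 2 is a square modulo p. -/
theorem legendreSym_ne_neg_one_of_dvd {r : ℤ} (hr : (q : ℤ) ∣ r ^ 2 - r + normOmega p) :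
    legendreSym p q ≠ -1 := by
  have : Fact q.Prime := ⟨hq⟩
  rcases eq_or_ne q 2 with rfl | hq2
  · have h1 : Even (r ^ 2 - r) := by
      rw [sq, ← mul_sub_one]
      exact Int.even_mul_pred_self r
    have h2 : (2 : ℤ) ∣ normOmega p := (dvd_add_right h1.two_dvd).1 (by exact_mod_cast hr)
    have h3 := four_mul_normOmega hp4
    rw [Ne, legendreSym.eq_neg_one_iff, not_not]
    have := (ZMod.exists_sq_eq_two_iff (p := p) (by omega)).2 (by omega)
    simpa using this
  · rw [← legendreSym_neg_eq_of_mod_four_eq_three p q hp4 hq2, Ne, legendreSym.eq_neg_one_iff,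
      not_not]
    obtain ⟨c, hc⟩ := hr
    have h4 := four_mul_sub_add_normOmega hp4 r
    rw [hc] at h4
    refine ⟨((2 * r - 1 : ℤ) : ZMod q), ?_⟩
    have h5 := congrArg (fun z : ℤ ↦ (z : ZMod q)) h4
    simp only [Int.cast_add, Int.cast_mul, Int.cast_pow, Int.cast_natCast, CharP.cast_eq_zero,
      zero_mul, mul_zero] at h5
    rw [Int.cast_neg, Int.cast_natCast]
    linear_combination h5

theorem exists_dvd_of_legendreSym_ne_neg_one (h : legendreSym p q ≠ -1) :
    ∃ r : ℤ, (q : ℤ) ∣ r ^ 2 - r + normOmega p := by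
  have : Fact q.Prime := ⟨hq⟩
  rcases eq_or_ne q 2 with rfl | hq2
  · refine ⟨0, ?_⟩
    rw [Ne, legendreSym.eq_neg_one_iff, not_not] at h
    have := (ZMod.exists_sq_eq_two_iff (p := p) (by omega)).1 (by simpa using h)
    have h3 := four_mul_normOmega hp4
    simp
    omega
  · rw [← legendreSym_neg_eq_of_mod_four_eq_three p q hp4 hq2, Ne, legendreSym.eq_neg_one_iff,
      not_not] at h
    obtain ⟨s, hs⟩ := h
    have h20 : (2 : ZMod q) ≠ 0 := by
      intro h2
      have : ((2 : ℕ) : ZMod q) = 0 := by exact_mod_cast h2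
      rw [ZMod.natCast_eq_zero_iff] at this
      exact hq2 ((Nat.prime_dvd_prime_iff_eq hq Nat.prime_two).1 this)
    obtain ⟨r, hr⟩ := ZMod.intCast_surjective ((s + 1) / 2)
    refine ⟨r, (ZMod.intCast_zmod_eq_zero_iff_dvd _ q).1 ?_⟩
    have h4 := congrArg (fun z : ℤ ↦ (z : ZMod q)) (four_mul_sub_add_normOmega hp4 r)
    have h5 : (2 : ZMod q) * r - 1 = s := by
      rw [hr]; field_simp; ring
    have h6 : (2 : ZMod q) * 2 * ((r ^ 2 - r + normOmega p : ℤ) : ZMod q) = 0 := by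
      push_cast at h4 hs ⊢
      rw [h5] at h4
      linear_combination h4 - hs
    exact (mul_eq_zero.1 h6).resolve_left (mul_ne_zero h20 h20)

theorem dvd_two_mul_sub_one_iff {r : ℤ} (hr : (q : ℤ) ∣ r ^ 2 - r + normOmega p) :
    (q : ℤ) ∣ 2 * r - 1 ↔ q = p := by
  have h4 := four_mul_sub_add_normOmega hp4 r
  have hd : (q : ℤ) ∣ (2 * r - 1) ^ 2 + p := h4 ▸ hr.mul_left 4
  constructor
  · intro h
    have : (q : ℤ) ∣ p := (dvd_add_right (h.trans (dvd_pow_self _ two_ne_zero))).1 hd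
    exact (Nat.prime_dvd_prime_iff_eq hq Fact.out).1 (by exact_mod_cast this)
  · rintro rfl
    exact Int.Prime.dvd_pow' hq ((dvd_add_left dvd_rfl).1 hd)

end Roots

section Primes

open Ideal

variable (hp4 : p % 4 = 3) (q : ℕ)

/-- The ideal `(q, ω - r)`. -/
noncomputable def rootIdeal (r : ℤ) : Ideal (𝓞 (QSqrtNeg p)) :=
  span {(q : 𝓞 (QSqrtNeg p)), omega hp4 - r}

theorem natCast_mem_rootIdeal (r : ℤ) : (q : 𝓞 (QSqrtNeg p)) ∈ rootIdeal hp4 q r :=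
  subset_span (by simp)

theorem omega_sub_mem_rootIdeal (r : ℤ) : omega hp4 - r ∈ rootIdeal hp4 q r :=
  subset_span (by simp)

theorem omega_sub_mul_omega_sub (r : ℤ) :
    (omega hp4 - r) * (omega hp4 - (1 - r : ℤ)) =
      -((r ^ 2 - r + normOmega p : ℤ) : 𝓞 (QSqrtNeg p)) := by
  push_cast
  linear_combination omega_sq hp4

variable {q}

theorem omega_sub_mul_omega_sub_mem {r : ℤ} (hr : (q : ℤ) ∣ r ^ 2 - r + normOmega p)
    {I : Ideal (𝓞 (QSqrtNeg p))} (hI : (q : 𝓞 (QSqrtNeg p)) ∈ I) :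
    (omega hp4 - r) * (omega hp4 - (1 - r : ℤ)) ∈ I := by
  obtain ⟨c, hc⟩ := hr
  rw [omega_sub_mul_omega_sub, hc]
  push_cast
  exact neg_mem (I.mul_mem_right _ hI)

theorem intCast_notMem (hq : q.Prime) {I : Ideal (𝓞 (QSqrtNeg p))} (hI : (q : 𝓞 (QSqrtNeg p)) ∈ I)
    (htop : I ≠ ⊤) {a : ℤ} (ha : ¬ (q : ℤ) ∣ a) : (a : 𝓞 (QSqrtNeg p)) ∉ I := by
  intro h
  refine htop ((eq_top_iff_one _).2 (one_mem_of_isCoprime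
    ((Nat.prime_iff_prime_int.1 hq).coprime_iff_not_dvd.2 ha) (by simpa using hI) h))

variable [Fact p.Prime] (hq : q.Prime)

include hq

theorem omega_sub_notMem_span (c : ℤ) : omega hp4 - c ∉ span {(q : 𝓞 (QSqrtNeg p))} := by
  rw [mem_span_singleton]
  rintro ⟨x, hx⟩
  obtain ⟨a, b, rfl⟩ := exists_eq_add_mul_omega hp4 x
  have := (eq_zero_of_add_mul_omega_eq_zero hp4 (a := q * a + c) (b := q * b - 1)
    (by push_cast; linear_combination -hx)).2
  exact (Nat.prime_iff_prime_int.1 hq).not_dvd_one ⟨b, by linarith⟩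

/-- If 1 = uq + v(ω - r), multiplying by the conjugate factor ω - (1 - r) would place that factor in
(q), although its ω-coefficient is 1. -/
theorem rootIdeal_ne_top {r : ℤ} (hr : (q : ℤ) ∣ r ^ 2 - r + normOmega p) :
    rootIdeal hp4 q r ≠ ⊤ := by
  intro htop
  refine omega_sub_notMem_span hp4 hq (1 - r) ?_
  have h1 : (1 : 𝓞 (QSqrtNeg p)) ∈ rootIdeal hp4 q r := htop ▸ Submodule.mem_top
  obtain ⟨u, v, huv⟩ := mem_span_pair.1 h1
  have : omega hp4 - (1 - r : ℤ) = u * (omega hp4 - (1 - r : ℤ)) * q +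
      v * ((omega hp4 - r) * (omega hp4 - (1 - r : ℤ))) := by
    linear_combination -(omega hp4 - (1 - r : ℤ)) * huv
  rw [this]
  exact add_mem (mul_mem_left _ _ (mem_span_singleton_self _))
    (mul_mem_left _ _ (omega_sub_mul_omega_sub_mem hp4 hr (mem_span_singleton_self _)))

theorem eq_span_or_absNorm_eq {I : Ideal (𝓞 (QSqrtNeg p))} (hI : (q : 𝓞 (QSqrtNeg p)) ∈ I)
    (htop : I ≠ ⊤) (hp4 : p % 4 = 3) : I = span {(q : 𝓞 (QSqrtNeg p))} ∨ absNorm I = q := by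
  have hN : absNorm (span {(q : 𝓞 (QSqrtNeg p))}) = q ^ 2 := by
    rw [absNorm_span_natCast, finrank_int hp4]
  have hle : span {(q : 𝓞 (QSqrtNeg p))} ≤ I := (span_singleton_le_iff_mem _).2 hI
  obtain ⟨k, hk, hk'⟩ := (Nat.dvd_prime_pow hq).1 (hN ▸ absNorm_dvd_absNorm_of_le hle)
  interval_cases k
  · exact absurd (absNorm_eq_one_iff.1 (by simpa using hk')) htop
  · right; simpa using hk'
  · left
    exact (eq_of_le_of_absNorm_eq hle (hN.trans hk'.symm)
      (by rw [hN]; exact pow_ne_zero _ hq.ne_zero)).symm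

theorem absNorm_rootIdeal {r : ℤ} (hr : (q : ℤ) ∣ r ^ 2 - r + normOmega p) :
    absNorm (rootIdeal hp4 q r) = q := by
  refine (eq_span_or_absNorm_eq hq (natCast_mem_rootIdeal hp4 q r)
    (rootIdeal_ne_top hp4 hq hr) hp4).resolve_left fun h ↦ ?_
  exact omega_sub_notMem_span hp4 hq r (h ▸ omega_sub_mem_rootIdeal hp4 q r)

theorem isMaximal_rootIdeal {r : ℤ} (hr : (q : ℤ) ∣ r ^ 2 - r + normOmega p) :
    (rootIdeal hp4 q r).IsMaximal := by
  have hn := absNorm_rootIdeal hp4 hq hr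
  have : (rootIdeal hp4 q r).IsPrime := isPrime_of_irreducible_absNorm (hn.symm ▸ hq)
  exact this.isMaximal fun h ↦ hq.ne_zero (by rw [← hn, h, absNorm_bot])

theorem eq_rootIdeal_or {r : ℤ} (hr : (q : ℤ) ∣ r ^ 2 - r + normOmega p)
    {P : Ideal (𝓞 (QSqrtNeg p))} (hP : P.IsMaximal) (hqP : (q : 𝓞 (QSqrtNeg p)) ∈ P) :
    P = rootIdeal hp4 q r ∨ P = rootIdeal hp4 q (1 - r) := by
  have hr' : (q : ℤ) ∣ (1 - r) ^ 2 - (1 - r) + normOmega p := by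
    rwa [show (1 - r) ^ 2 - (1 - r) + (normOmega p : ℤ) = r ^ 2 - r + normOmega p by ring]
  have h (s : ℤ) (hs : (q : ℤ) ∣ s ^ 2 - s + normOmega p) (hmem : omega hp4 - s ∈ P) :
      P = rootIdeal hp4 q s := by
    refine ((isMaximal_rootIdeal hp4 hq hs).eq_of_le hP.ne_top (span_le.2 ?_)).symm
    rintro x (rfl | rfl)
    · exact hqP
    · exact hmem
  exact (hP.isPrime.mem_or_mem (omega_sub_mul_omega_sub_mem hp4 hr hqP)).imp (h r hr)
    (h (1 - r) hr')

theorem rootIdeal_eq_iff {r : ℤ} (hr : (q : ℤ) ∣ r ^ 2 - r + normOmega p) :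
    rootIdeal hp4 q r = rootIdeal hp4 q (1 - r) ↔ (q : ℤ) ∣ 2 * r - 1 := by
  constructor
  · intro h
    by_contra hnd
    refine intCast_notMem hq (natCast_mem_rootIdeal hp4 q r) (rootIdeal_ne_top hp4 hq hr) hnd ?_
    have h1 := omega_sub_mem_rootIdeal hp4 q (1 - r)
    rw [← h] at h1
    have := sub_mem h1 (omega_sub_mem_rootIdeal hp4 q r)
    convert this using 1
    push_cast
    ring
  · rintro ⟨c, hc⟩
    have hmem : omega hp4 - (1 - r : ℤ) ∈ rootIdeal hp4 q r := by
      have e : omega hp4 - (1 - r : ℤ) = (omega hp4 - r) + (c : 𝓞 (QSqrtNeg p)) * q := by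
        have : ((2 * r - 1 : ℤ) : 𝓞 (QSqrtNeg p)) = ((q * c : ℤ) : 𝓞 (QSqrtNeg p)) := by rw [hc]
        push_cast at this ⊢
        linear_combination this
      rw [e]
      exact add_mem (omega_sub_mem_rootIdeal hp4 q r)
        (mul_mem_left _ _ (natCast_mem_rootIdeal hp4 q r))
    have hr' : (q : ℤ) ∣ (1 - r) ^ 2 - (1 - r) + normOmega p := by
      rwa [show (1 - r) ^ 2 - (1 - r) + (normOmega p : ℤ) = r ^ 2 - r + normOmega p by ring]
    refine ((isMaximal_rootIdeal hp4 hq hr').eq_of_le (rootIdeal_ne_top hp4 hq hr)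
      (span_le.2 ?_)).symm
    rintro x (rfl | rfl)
    · exact natCast_mem_rootIdeal hp4 q r
    · exact hmem

/-- Otherwise P has norm q, its residue ring is additively generated by 1, and ω is congruent to an
integer r modulo P; then r is a root modulo q. -/
theorem eq_span_of_forall_not_dvd (hp4 : p % 4 = 3)
    (hr : ∀ r : ℤ, ¬ (q : ℤ) ∣ r ^ 2 - r + normOmega p)
    {P : Ideal (𝓞 (QSqrtNeg p))} (hP : P.IsMaximal) (hqP : (q : 𝓞 (QSqrtNeg p)) ∈ P) :
    P = span {(q : 𝓞 (QSqrtNeg p))} := by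
  refine (eq_span_or_absNorm_eq hq hqP hP.ne_top hp4).resolve_right fun hn ↦ ?_
  have : Fact q.Prime := ⟨hq⟩
  have hcard : Nat.card (𝓞 (QSqrtNeg p) ⧸ P) = q := hn
  have h1 : (1 : 𝓞 (QSqrtNeg p) ⧸ P) ≠ 0 := by
    have := Ideal.Quotient.nontrivial_iff.2 hP.ne_top
    exact one_ne_zero
  have htop := zmultiples_eq_top_of_prime_card hcard h1
  obtain ⟨r, hr1⟩ := AddSubgroup.mem_zmultiples_iff.1
    (htop ▸ AddSubgroup.mem_top (Ideal.Quotient.mk P (omega hp4)) :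
      Ideal.Quotient.mk P (omega hp4) ∈ AddSubgroup.zmultiples 1)
  have hmem : omega hp4 - r ∈ P := by
    rw [← Ideal.Quotient.eq_zero_iff_mem, map_sub, ← hr1]
    simp
  have h2 := P.mul_mem_right (omega hp4 - (1 - r : ℤ)) hmem
  rw [omega_sub_mul_omega_sub, neg_mem_iff] at h2
  exact intCast_notMem hq hqP hP.ne_top (hr r) h2

/-- The three values of the symbol are the three types of splitting: -1 inert (1 or 0 by the parity
of k), 0 ramified (always 1, from the term i = 0), 1 split (k + 1). -/
theorem normCount_prime_pow (hp4 : p % 4 = 3) (k : ℕ) :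
    (normCount (𝓞 (QSqrtNeg p)) (q ^ k) : ℤ) = ∑ i ∈ range (k + 1), legendreSym p q ^ i := by
  have hz : legendreSym p q = 0 ↔ q = p := by
    rw [legendreSym.eq_zero_iff, Int.cast_natCast, ZMod.natCast_eq_zero_iff,
      Nat.prime_dvd_prime_iff_eq Fact.out hq, eq_comm]
  by_cases h : legendreSym p q = -1
  · have hr : ∀ r : ℤ, ¬ (q : ℤ) ∣ r ^ 2 - r + normOmega p := fun r hr ↦
      legendreSym_ne_neg_one_of_dvd hp4 hq hr h
    rw [normCount_prime_pow_of_unique hq two_pos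
      (by rw [absNorm_span_natCast, finrank_int hp4])
      (fun P hP hqP ↦ eq_span_of_forall_not_dvd hq hp4 hr hP hqP), h, neg_one_geom_sum]
    simp only [even_iff_two_dvd]
    split_ifs <;> first | rfl | omega
  · obtain ⟨r, hr⟩ := exists_dvd_of_legendreSym_ne_neg_one hp4 hq h
    have hr' : (q : ℤ) ∣ (1 - r) ^ 2 - (1 - r) + normOmega p := by
      rwa [show (1 - r) ^ 2 - (1 - r) + (normOmega p : ℤ) = r ^ 2 - r + normOmega p by ring]
    have hP := fun P hP hqP ↦ eq_rootIdeal_or hp4 hq hr (P := P) hP hqP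
    by_cases h0 : q = p
    · rw [hz.2 h0]
      have he := (rootIdeal_eq_iff hp4 hq hr).2 ((dvd_two_mul_sub_one_iff hp4 hq hr).2 h0)
      rw [← he] at hP
      rw [normCount_prime_pow_of_unique (f := 1) hq one_pos
        (by rw [absNorm_rootIdeal hp4 hq hr, pow_one]) fun P h1 h2 ↦ (or_self_iff.1 (hP P h1 h2))]
      simp [sum_range_succ']
    · have h1 : legendreSym p q = 1 := by
        rcases quadraticChar_isQuadratic (ZMod p) ((q : ℤ) : ZMod p) with h2 | h2 | h2
        · exact absurd (hz.1 h2) h0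
        · exact h2
        · exact absurd h2 h
      have hne := (rootIdeal_eq_iff hp4 hq hr).not.2
        ((dvd_two_mul_sub_one_iff hp4 hq hr).not.2 h0)
      rw [normCount_prime_pow_of_two hq (absNorm_rootIdeal hp4 hq hr)
        (absNorm_rootIdeal hp4 hq hr') hne hP, h1]
      simp

end Primes

/-! ### Factorisation of the zeta function and the class number formula -/

section ClassNumber

variable (p) [Fact p.Prime]

/-- The quadratic character modulo `p`, as a complex Dirichlet character. -/
noncomputable def dirichletChar : DirichletCharacter ℂ p :=
  (quadraticChar (ZMod p)).ringHomComp (Int.castRingHom ℂ)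

theorem dirichletChar_apply (a : ZMod p) :
    dirichletChar p a = (quadraticChar (ZMod p) a : ℂ) := rfl

variable {p}

theorem normCount_eq_zetaMul (hp4 : p % 4 = 3) {n : ℕ} (hn : n ≠ 0) :
    (Ideal.normCount (𝓞 (QSqrtNeg p)) n : ℂ) = (dirichletChar p).zetaMul n := by
  -- The value at 0 is overwritten because the zero ideal has norm 0, whereas an arithmetic function
  -- must vanish there.
  set c : ArithmeticFunction ℂ :=
    ⟨fun n ↦ if n = 0 then 0 else (Ideal.normCount (𝓞 (QSqrtNeg p)) n : ℂ), if_pos rfl⟩ with hc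
  have hcn {n : ℕ} (hn : n ≠ 0) : c n = (Ideal.normCount (𝓞 (QSqrtNeg p)) n : ℂ) := if_neg hn
  rw [← hcn hn]
  congr 1
  have hmul : c.IsMultiplicative := by
    refine ArithmeticFunction.IsMultiplicative.iff_ne_zero.2 ⟨?_, fun hm hn hmn ↦ ?_⟩
    · rw [hcn one_ne_zero, Ideal.normCount_one, Nat.cast_one]
    · rw [hcn (mul_ne_zero hm hn), hcn hm, hcn hn, Ideal.normCount_mul hmn hm, Nat.cast_mul]
  refine (hmul.eq_iff_eq_on_prime_powers _ _
    (DirichletCharacter.isMultiplicative_zetaMul _)).2 fun q k hq ↦ ?_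
  rw [hcn (pow_ne_zero _ hq.ne_zero), DirichletCharacter.zetaMul,
    ArithmeticFunction.coe_zeta_mul_apply, Nat.sum_divisors_prime_pow hq]
  have := congrArg (fun z : ℤ ↦ (z : ℂ)) (normCount_prime_pow hq hp4 k)
  push_cast at this
  rw [this]
  refine sum_congr rfl fun i _ ↦ ?_
  simp [toArithmeticFunction, hq.ne_zero, dirichletChar_apply, legendreSym, -quadraticChar_apply]

theorem LSeries_zetaMul_dirichletChar {s : ℂ} (hs : 1 < s.re) :
    LSeries (dirichletChar p).zetaMul s = riemannZeta s *
      LSeries (fun n ↦ (quadraticChar (ZMod p) (n : ZMod p) : ℂ)) s := by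
  have h1 : LSeriesSummable ((ArithmeticFunction.zeta : ArithmeticFunction ℂ) ·) s := by
    simpa using ArithmeticFunction.LSeriesSummable_zeta_iff.mpr hs
  have h2 : LSeriesSummable (toArithmeticFunction (dirichletChar p ·)) s := by
    refine LSeriesSummable_of_bounded_of_one_lt_re (m := 1) (fun n hn ↦ ?_) hs
    simpa [toArithmeticFunction, hn] using DirichletCharacter.norm_le_one (dirichletChar p) _
  have h3 : LSeries (toArithmeticFunction (dirichletChar p ·)) s =
      LSeries (fun n ↦ (quadraticChar (ZMod p) (n : ZMod p) : ℂ)) s :=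
    LSeries_congr (fun hn ↦ by simp [toArithmeticFunction, hn, dirichletChar_apply]) s
  have h4 : LSeries ((ArithmeticFunction.zeta : ArithmeticFunction ℂ) ·) s = riemannZeta s := by
    simpa using ArithmeticFunction.LSeries_zeta_eq_riemannZeta hs
  have h := ArithmeticFunction.LSeries_mul' (f := (ArithmeticFunction.zeta : ArithmeticFunction ℂ))
    (g := toArithmeticFunction (dirichletChar p ·)) h1 h2
  rw [h4, h3] at h
  rw [← h, DirichletCharacter.zetaMul]

theorem dedekindZeta_eq (hp4 : p % 4 = 3) {s : ℂ} (hs : 1 < s.re) :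
    dedekindZeta (QSqrtNeg p) s = riemannZeta s *
      LSeries (fun n ↦ (quadraticChar (ZMod p) (n : ZMod p) : ℂ)) s := by
  rw [dedekindZeta, ← LSeries_zetaMul_dirichletChar hs]
  exact LSeries_congr (fun hn ↦ normCount_eq_zetaMul hp4 hn) s

/-- Dirichlet's class number formula for `ℚ(√-p)`. -/
theorem p_mul_h2minus (hp4 : p % 4 = 3) (hp3 : 3 < p) :
    (p : ℤ) * h2minus p = -∑ a : ZMod p, quadraticChar (ZMod p) a * (a.val : ℤ) := by
  have hp : p.Prime := Fact.out
  have hpos : (0 : ℝ) < p := by exact_mod_cast hp.pos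
  have h1 := tendsto_sub_one_mul_dedekindZeta_nhdsGT (QSqrtNeg p)
  have h2 : Tendsto (fun s : ℝ ↦ ((s : ℂ) - 1) * riemannZeta s) (𝓝[>] 1) (𝓝 1) := by
    refine riemannZeta_residue_one.comp (tendsto_nhdsWithin_iff.2 ⟨?_, ?_⟩)
    · exact (Complex.continuous_ofReal.tendsto' 1 1 Complex.ofReal_one).mono_left
        nhdsWithin_le_nhds
    · filter_upwards [self_mem_nhdsWithin] with s hs
      have hs' : (1 : ℝ) < s := hs
      exact fun h ↦ hs'.ne' (by simpa using h)
  have h3 := h2.mul (tendsto_LSeries_quadraticChar p hp4)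
  rw [one_mul] at h3
  have h4 := tendsto_nhds_unique (h1.congr' ?_) h3
  · rw [dedekindZeta_residue_eq hp4 hp3] at h4
    have h5 := Complex.ofReal_injective h4
    have hs : Real.sqrt p ≠ 0 := (Real.sqrt_pos.2 hpos).ne'
    have hpi := Real.pi_ne_zero
    have h6 : (p : ℝ) * h2minus p =
        -((∑ a : ZMod p, quadraticChar (ZMod p) a * (a.val : ℤ) : ℤ) : ℝ) := by
      field_simp at h5
      linarith
    exact_mod_cast h6
  · filter_upwards [self_mem_nhdsWithin] with s hs
    rw [dedekindZeta_eq hp4 (by simpa using hs), mul_assoc]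

end ClassNumber

end QSqrtNeg

/-! ### The sum of the residues and the digit sums -/

theorem two_mul_sum_val_squares (p : ℕ) [Fact p.Prime] (hp4 : p % 4 = 3) (hp3 : 3 < p) :
    (∑ x : ZMod p with quadraticChar (ZMod p) x = 1, (x.val : ℚ)) =
      p * ((p - 1) / 4 - h2minus p / 2) := by
  have h1 := two_mul_sum_val_quadraticChar_eq_one p
  have h2 := QSqrtNeg.p_mul_h2minus hp4 hp3
  have h3 : ∑ x : ZMod p, (x.val : ℤ) = ((∑ i ∈ range p, i : ℕ) : ℤ) := by
    rw [← ZMod.sum_val_eq_sum_range p (fun i ↦ i)]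
    push_cast
    rfl
  have h4 : (∑ i ∈ range p, i) * 2 = p * (p - 1) := Finset.sum_range_id_mul_two p
  have h5 : ((∑ i ∈ range p, i : ℕ) : ℚ) * 2 = p * (p - 1) := by
    rw [← Nat.cast_pred (by omega : 0 < p)]
    exact_mod_cast h4
  rw [← neg_eq_iff_eq_neg.2 h2, h3] at h1
  have h6 : 2 * ∑ x : ZMod p with quadraticChar (ZMod p) x = 1, (x.val : ℚ) =
      ((∑ i ∈ range p, i : ℕ) : ℚ) + -(p * h2minus p) := by exact_mod_cast h1
  linarith

end

theorem theorem3 (p : ℕ) [Fact p.Prime] (hp4 : p % 4 = 3) (hp3 : 3 < p)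
    (g : ℤ) (hg : IsPrimitiveRoot (g : ZMod p) (p - 1))
    (b : ℕ) [NeZero b] (hb : 2 ≤ b) (hbres : legendreSym p (b : ℤ) = 1)
    (d : ℕ) (hd : d = orderOf (b : ZMod p)) :
    (∀ j < (p - 1) / (2 * d),
      IsLeast {m : ℕ | 0 < m ∧ Function.Periodic (periodDigit p b g j) m} d) ∧
    ((∑ j ∈ Finset.range ((p - 1) / (2 * d)), ∑ k ∈ Finset.range d, periodDigit p b g j k : ℕ) : ℚ)
      = ((b : ℚ) - 1) * ((p : ℚ) - 1) / 4 - ((b : ℚ) - 1) * (h2minus p : ℚ) / 2 := by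
  have hg0 : (g : ZMod p) ≠ 0 := hg.ne_zero (by omega)
  have hbd : (b : ZMod p) ^ d = 1 := hd ▸ pow_orderOf_eq_one _
  constructor
  · intro j _
    refine ⟨⟨?_, (periodic_periodDigit_iff p b g hb hg0 j d).2 hbd⟩, fun m hm ↦ ?_⟩
    · refine Nat.pos_of_dvd_of_pos (hd ▸ orderOf_dvd_of_legendreSym_eq_one p hbres) ?_
      omega
    · exact hd ▸ Nat.le_of_dvd hm.1
        (orderOf_dvd_of_pow_eq_one ((periodic_periodDigit_iff p b g hb hg0 j m).1 hm.2))
  · have hp0 : (p : ℚ) ≠ 0 := by exact_mod_cast (by omega : p ≠ 0)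
    refine mul_left_cancel₀ hp0 ?_
    push_cast
    rw [Finset.mul_sum, Finset.sum_congr rfl fun j _ ↦ mul_sum_periodDigit p b g j d hbd, ← Finset.mul_sum, hd,
      sum_sum_pow_mul_pow p (by omega) (g : ZMod p) hg b hbres (fun x ↦ (x.val : ℚ)),
      two_mul_sum_val_squares p hp4 hp3]
    ring
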